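/- **Setting.** Let $\mathcal H_A=\mathcal H_B=\mathbb C^d$ and $\mathcal H_{AB}=\mathcal H_A\otimes\mathcal H_B$, of dimension $D=d^2$, and let $\rho$ be a quantum state (density matrix) on $\mathcal H_{AB}$ with reduced state $\rho_A=\mathrm{Tr}_B(\rho)$. Put $$p_n=\mathrm{Tr}(\rho^n),\qquad a_n=\mathrm{Tr}(\rho_A^n),\qquad t_2=\mathrm{Tr}_A[\rho_A\,\mathrm{Tr}_B(\rho^2)].$$ A probability measure $\nu$ on the unitary group of $\mathbb C^N$ is a *unitary 3-design* if $\int U^{\otimes3}A(U^\dagger)^{\otimes3}\,d\nu(U)$ equals the same integral over the Haar probability measure, for every operator $A$ on $(\mathbb C^N)^{\otimes3}$. **Classical shadows.** One run on a state $\sigma$ on $\mathbb C^N$ draws $U\sim\nu$, measures $U\sigma U^\dagger$ in the computational basis with outcome $b$ (of probability $\langle b|U\sigma U^\dagger|b\rangle$ given $U$), and records $\hat\sigma=(N+1)U^\dagger|b\rangle\langle b|U-I$. Different runs use different copies of the state and are independent. Let $\nu$ and $\nu_A$ be unitary 3-designs on $\mathcal H_{AB}$ and $\mathcal H_A$. From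 $M$ runs on $\rho$ (with $\nu$), giving $\hat\rho_1,\dots,\hat\rho_M$, and $L$ runs on $\rho_A$ (with $\nu_A$), giving $\hat a_1,\dots,\hat a_L$, form $$\hat p_2=\binom M2^{-1}\sum_{j<k}\mathrm{Tr}(\hat\rho_j\hat\rho_k),\qquad \hat p_3=\frac12\binom M3^{-1}\sum_{i<j<k}\bigl[\mathrm{Tr}(\hat\rho_i\hat\rho_j\hat\rho_k)+\mathrm{Tr}(\hat\rho_j\hat\rho_i\hat\rho_k)\bigr],$$ $$\hat t_2=\frac1{LM(M-1)}\sum_{\ell}\sum_{i\ne j}\mathrm{Tr}\bigl[(\hat a_\ell\otimes I)\hat\rho_i\hat\rho_j\bigr],$$ and $\hat a_2,\hat a_3$ by the formulas of $\hat p_2,\hat p_3$ with $\hat a_1,\dots,\hat a_L$ in place of $\hat\rho_1,\dots,\hat\rho_M$. **Theorem.** With access to unitary 3-designs, the sample complexity of estimating $p_2,p_3,a_2,a_3,t_2$ to constant accuracy by classical shadows is $\mathcal O(D)$. Precisely: for every $\varepsilon>0$ there is a natural number $C$, depending only on $\varepsilon$, such that for all $d$, all states $\rho$ on $\mathcal H_{AB}$,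 all unitary 3-designs $\nu$ on $\mathcal H_{AB}$ and $\nu_A$ on $\mathcal H_A$, and all $M\ge CD$ and $L\ge CD$, each of $\hat p_2,\hat p_3,\hat a_2,\hat a_3,\hat t_2$ is square integrable, has expectation $p_2,p_3,a_2,a_3,t_2$ respectively, and has variance at most $\varepsilon^2$. (In particular $M=L=CD$ runs, at most $2CD$ samples in total, suffice for each of them.) -/

import Mathlib

open MeasureTheory ProbabilityTheory
open scoped Kronecker ComplexOrder

noncomputable section

namespace ClassicalShadow

section Unitary

variable {n : Type*} [Fintype n] [DecidableEq n]

/-- The Borel σ-algebra on the unitary group. -/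
instance instMeasurableSpaceUnitary : MeasurableSpace (Matrix.unitaryGroup n ℂ) := borel _

instance instBorelSpaceUnitary : BorelSpace (Matrix.unitaryGroup n ℂ) := ⟨rfl⟩

instance instCompactSpaceUnitary : CompactSpace (Matrix.unitaryGroup n ℂ) := by
  apply isCompact_iff_compactSpace.mp
  have hK : IsCompact (Set.pi Set.univ fun _ : n =>
      Set.pi Set.univ fun _ : n => Metric.closedBall (0 : ℂ) 1) :=
    isCompact_univ_pi fun _ => isCompact_univ_pi fun _ => isCompact_closedBall _ _
  have hcl : IsClosed (Matrix.unitaryGroup n ℂ : Set (Matrix n n ℂ)) := isClosed_unitary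
  exact hK.of_isClosed_subset hcl fun U hU i _ j _ => by
    simpa using entry_norm_bound_of_unitary hU i j

/-- The normalized Haar measure on the unitary group. -/
def haarUnitary (n : Type*) [Fintype n] [DecidableEq n] : Measure (Matrix.unitaryGroup n ℂ) :=
  Measure.haarMeasure ⊤

/-- The tensor power `A^{⊗t}`, as a matrix indexed by `t`-tuples of basis labels. -/
def tensorPower (t : ℕ) (A : Matrix n n ℂ) : Matrix (Fin t → n) (Fin t → n) ℂ :=
  Matrix.of fun i j => ∏ s, A (i s) (j s)

/-- A unitary ensemble, given as a probability measure `ν` on the unitary group, is a unitary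
`t`-design if its `t`-fold twirl `A ↦ 𝔼 U^{⊗t} A (U^†)^{⊗t}` agrees with the Haar twirl. A finite
ensemble corresponds to the uniform measure on it. The matrix-valued integrals are written
entrywise. -/
def IsUnitaryDesign (t : ℕ) (ν : Measure (Matrix.unitaryGroup n ℂ)) : Prop :=
  ∀ (A : Matrix (Fin t → n) (Fin t → n) ℂ) (i j : Fin t → n),
    ∫ U, (tensorPower t (U : Matrix n n ℂ) * A * (tensorPower t (U : Matrix n n ℂ)).conjTranspose)
        i j ∂ν =
      ∫ U, (tensorPower t (U : Matrix n n ℂ) * A *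
        (tensorPower t (U : Matrix n n ℂ)).conjTranspose) i j ∂(haarUnitary n)

end Unitary

/-- Density matrices (quantum states). -/
def IsState {n : Type*} [Fintype n] (ρ : Matrix n n ℂ) : Prop :=
  ρ.PosSemidef ∧ ρ.trace = 1

/-- The partial trace over the second tensor factor. -/
def traceB {a b : Type*} [Fintype b] (X : Matrix (a × b) (a × b) ℂ) : Matrix a a ℂ :=
  Matrix.of fun i j => ∑ k, X (i, k) (j, k)

section Protocol

variable {n : Type*} [Fintype n] [DecidableEq n]

/-- The probability `⟨b|U ρ U^†|b⟩` of the outcome `b` when the rotated state `U ρ U^†` is measured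
in the computational basis. -/
def outcomeProb (ρ : Matrix n n ℂ) (U : Matrix.unitaryGroup n ℂ) (b : n) : ℝ :=
  (((U : Matrix n n ℂ) * ρ * (U : Matrix n n ℂ).conjTranspose) b b).re

/-- The classical shadow `(D + 1) U^†|b⟩⟨b|U - I` built from the data `(U, b)` of one run. -/
def shadow (x : Matrix.unitaryGroup n ℂ × n) : Matrix n n ℂ :=
  ((Fintype.card n : ℂ) + 1) •
    ((x.1 : Matrix n n ℂ).conjTranspose * Matrix.single x.2 x.2 1 * (x.1 : Matrix n n ℂ)) - 1

/-- The law of the data `(U, b)` of one run: `U` is drawn from `ν`, and given `U`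
the outcome `b` occurs with probability `⟨b|U ρ U^†|b⟩`. -/
def runLaw [MeasurableSpace n] (ν : Measure (Matrix.unitaryGroup n ℂ)) (ρ : Matrix n n ℂ) :
    Measure (Matrix.unitaryGroup n ℂ × n) :=
  ∑ b, (ν.withDensity fun U => ENNReal.ofReal (outcomeProb ρ U b)).map fun U => (U, b)

/-- The law of the data of `M` independent runs on `M` copies of `ρ`. -/
def dataLaw [MeasurableSpace n] (ν : Measure (Matrix.unitaryGroup n ℂ)) (ρ : Matrix n n ℂ)
    (M : ℕ) : Measure (Fin M → Matrix.unitaryGroup n ℂ × n) :=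
  Measure.pi fun _ => runLaw ν ρ

/-- The estimator of `Tr(ρ²)`: the average of `Tr(ρ̂_j ρ̂_k)` over `j < k`. -/
def estSecond {M : ℕ} (x : Fin M → Matrix.unitaryGroup n ℂ × n) : ℝ :=
  ((M.choose 2 : ℝ))⁻¹ *
    ∑ j, ∑ k ∈ Finset.Ioi j, ((shadow (x j) * shadow (x k)).trace).re

/-- The estimator of `Tr(ρ³)`: the average over `i < j < k` of
`(Tr(ρ̂_i ρ̂_j ρ̂_k) + Tr(ρ̂_j ρ̂_i ρ̂_k)) / 2`, which is a real number. -/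
def estThird {M : ℕ} (x : Fin M → Matrix.unitaryGroup n ℂ × n) : ℝ :=
  (1 / 2) * ((M.choose 3 : ℝ))⁻¹ *
      (∑ i, ∑ j ∈ Finset.Ioi i, ∑ k ∈ Finset.Ioi j,
        (shadow (x i) * shadow (x j) * shadow (x k)).trace).re +
    (1 / 2) * ((M.choose 3 : ℝ))⁻¹ *
      (∑ i, ∑ j ∈ Finset.Ioi i, ∑ k ∈ Finset.Ioi j,
        (shadow (x j) * shadow (x i) * shadow (x k)).trace).re

end Protocol

/-- The estimator of `t₂ = Tr_A[ρ_A Tr_B(ρ²)]` from `M` runs on the bipartite state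
(shadows `ρ̂_i`) and `L` runs on its first party (shadows `â_ℓ`): the average of
`Tr[(â_ℓ ⊗ I) ρ̂_i ρ̂_j]` over all `ℓ` and all `i ≠ j`, which is a real number. -/
def estT2 {a b : Type*} [Fintype a] [DecidableEq a] [Fintype b] [DecidableEq b] {M L : ℕ}
    (z : (Fin M → Matrix.unitaryGroup (a × b) ℂ × (a × b)) ×
      (Fin L → Matrix.unitaryGroup a ℂ × a)) : ℝ :=
  ((L : ℝ) * M * ((M : ℝ) - 1))⁻¹ *
    (∑ l, ∑ i, ∑ j ∈ Finset.univ.erase i,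
      ((shadow (z.2 l) ⊗ₖ (1 : Matrix b b ℂ)) * shadow (z.1 i) * shadow (z.1 j)).trace).re

/-- The real random variable `X` is, under the law `P`, an unbiased estimator of `θ` with
standard deviation at most `ε`. -/
def EstimatesWithin {Ω : Type*} [MeasurableSpace Ω] (P : Measure Ω) (X : Ω → ℝ) (θ ε : ℝ) : Prop :=
  MemLp X 2 P ∧ ∫ ω, X ω ∂P = θ ∧ variance X P ≤ ε ^ 2

end ClassicalShadow

end

/-! Write each shadow as its mean plus centred noise, `ρ̂ = ρ + Z`. Every estimator is the real part
of an average of `Tr ∏ₛ (Z + C)` over tuples of distinct runs (for the third moments, the mean of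
two such averages). Expand each product by the set `a` of slots that carry noise. The term `a = ∅`
is the quantity to be estimated; every other term has mean zero, since a noisy run occurs in exactly
one slot.

Single-run estimate: `E|Tr(Z A)|² ≤ 4‖A‖²` in Hilbert–Schmidt norm, with a constant free of the
dimension (`isNoise_shadow`). The outcome probability is itself a diagonal entry of a rotated
matrix, so this second moment is a third moment of such entries. The design property replaces it by
a Haar moment, which `card_mul_haarMoment_three` evaluates from the infinitesimal form of right
invariance. Applying the estimate row by row gives `E‖Z A‖² ≤ 4D‖A‖²`. Integrating out one run at a
time then bounds the second moment of a term with noise in `a` by `64 D^|a|`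
(`integral_norm_noiseTerm_two_le`, `integral_norm_noiseTerm_three_le`).

Averaging gains this back. Two terms with the same `a` are orthogonal as soon as some noisy run of
the second is absent from the first. Since each slot ranges over at least `cD` runs, at most a
fraction of order `(cD)^(-|a|)` of the pairs survives. The powers of `D` cancel, and a variance of
order `1/c` remains (`integral_norm_mean_traceProd_sub_sq_le`).

For `t₂` the noise of a run on `ρ_A` enters as `Z ⊗ I`. As a linear functional it costs a factor
`dim B` more, and as a left multiplier only `dim A`. Reading the trace cyclically so that another
noisy slot, if there is one, plays the functional where needed keeps the same bound. -/

noncomputable section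

namespace ClassicalShadow

/-! ### Haar moments of diagonal entries, up to degree three -/

section Haar

variable {n : Type*} [Fintype n] [DecidableEq n]

/-- The diagonal entry `⟨b|U A U^†|b⟩`, as a linear functional of `A`. -/
def rotEntry (U : Matrix.unitaryGroup n ℂ) (b : n) : Matrix n n ℂ →ₗ[ℂ] ℂ where
  toFun A := ((U : Matrix n n ℂ) * A * (U : Matrix n n ℂ).conjTranspose) b b
  map_add' A B := by simp [mul_add, add_mul]
  map_smul' c A := by simp

lemma rotEntry_apply (U : Matrix.unitaryGroup n ℂ) (b : n) (A : Matrix n n ℂ) :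
    rotEntry U b A = ((U : Matrix n n ℂ) * A * (U : Matrix n n ℂ).conjTranspose) b b := rfl

lemma unitary_mul_conjTranspose (U : Matrix.unitaryGroup n ℂ) :
    (U : Matrix n n ℂ) * (U : Matrix n n ℂ).conjTranspose = 1 :=
  Matrix.mem_unitaryGroup_iff.1 U.2

lemma rotEntry_one (U : Matrix.unitaryGroup n ℂ) (b : n) : rotEntry U b 1 = 1 := by
  simp [rotEntry_apply, unitary_mul_conjTranspose]

lemma rotEntry_mul (U V : Matrix.unitaryGroup n ℂ) (b : n) (A : Matrix n n ℂ) :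
    rotEntry (U * V) b A =
      rotEntry U b ((V : Matrix n n ℂ) * A * (V : Matrix n n ℂ).conjTranspose) := by
  simp [rotEntry_apply, Matrix.conjTranspose_mul, mul_assoc]

lemma continuous_rotEntry (b : n) (A : Matrix n n ℂ) :
    Continuous fun U : Matrix.unitaryGroup n ℂ => rotEntry U b A := by
  simp only [rotEntry_apply]
  have h : Continuous fun U : Matrix.unitaryGroup n ℂ => (U : Matrix n n ℂ) :=
    continuous_subtype_val
  exact ((h.matrix_mul continuous_const).matrix_mul h.matrix_conjTranspose).matrix_elem b b

lemma rotEntry_conjTranspose (U : Matrix.unitaryGroup n ℂ) (b : n) (A : Matrix n n ℂ) :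
    rotEntry U b A.conjTranspose = star (rotEntry U b A) := by
  rw [rotEntry_apply, rotEntry_apply, ← Matrix.conjTranspose_apply]
  simp only [Matrix.conjTranspose_mul, Matrix.conjTranspose_conjTranspose, mul_assoc]

instance : IsProbabilityMeasure (haarUnitary n) :=
  ⟨by simpa [haarUnitary] using
    Measure.haarMeasure_self
        (K₀ := (⊤ : TopologicalSpace.PositiveCompacts (Matrix.unitaryGroup n ℂ)))⟩

instance : (haarUnitary n).IsHaarMeasure :=
  inferInstanceAs (Measure.haarMeasure ⊤).IsHaarMeasure

/-- A compact group is unimodular: the right translate of the Haar probability measure is again a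
Haar probability measure, hence the same one. -/
instance : (haarUnitary n).IsMulRightInvariant where
  map_mul_right_eq_self g := by
    have h1 : IsProbabilityMeasure ((haarUnitary n).map (· * g)) :=
      Measure.isProbabilityMeasure_map (measurable_mul_const g).aemeasurable
    have : ((haarUnitary n).map (· * g)).IsHaarMeasure := inferInstance
    exact Measure.isHaarMeasure_eq_of_isProbabilityMeasure _ _

/-- The Haar average of a product of three diagonal entries. -/
def haarMoment (b : n) (A B C : Matrix n n ℂ) : ℂ :=
  ∫ U, rotEntry U b A * rotEntry U b B * rotEntry U b C ∂(haarUnitary n)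

/-- All sample spaces are compact and all random variables continuous, so this settles every
integrability question below. -/
lemma integrable_of_continuous {X E : Type*} [TopologicalSpace X] [CompactSpace X]
    [MeasurableSpace X] [OpensMeasurableSpace X] [NormedAddCommGroup E]
    {μ : Measure X} [IsFiniteMeasure μ] {f : X → E} (hf : Continuous f) : Integrable f μ :=
  hf.integrable_of_hasCompactSupport (HasCompactSupport.of_compactSpace f)

section
open scoped Matrix.Norms.L2Operator

/-- The path is `V s = exp(i s H)`; differentiating the conjugation by it produces the commutator
with `iH`. -/
lemma exists_unitary_path (H : selfAdjoint (Matrix n n ℂ)) :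
    ∃ V : ℝ → Matrix.unitaryGroup n ℂ, V 0 = 1 ∧
      ∀ (U : Matrix.unitaryGroup n ℂ) (b : n) (A : Matrix n n ℂ) (t : ℝ),
      HasDerivAt (fun s : ℝ => rotEntry (U * V s) b A)
        (rotEntry (U * V t) b (Complex.I • ((H : Matrix n n ℂ) * A - A * H))) t := by
  refine ⟨fun s => selfAdjoint.expUnitary (s • H), by simp, fun U b A t => ?_⟩
  set X : Matrix n n ℂ := Complex.I • (H : Matrix n n ℂ) with hX
  have hV : ∀ s : ℝ, ((selfAdjoint.expUnitary (s • H) : Matrix.unitaryGroup n ℂ) : Matrix n n ℂ)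
      = NormedSpace.exp (s • X) := by
    intro s
    rw [selfAdjoint.expUnitary_coe, hX]
    congr 1
    exact smul_comm _ _ _
  have hd : HasDerivAt (fun s : ℝ => NormedSpace.exp (s • X)) (NormedSpace.exp (t • X) * X) t :=
    hasDerivAt_exp_smul_const X t
  have hds := hd.star
  have hXs : star X = -X := by
    have := H.2
    rw [selfAdjoint.mem_iff] at this
    simp only [hX, star_smul, this]
    simp
  have hm := (hd.mul_const A).mul hds
  have hL := (((LinearMap.toContinuousLinearMap (rotEntry U b)).restrictScalars ℝ).hasFDerivAt
    (x := NormedSpace.exp (t • X) * A * star (NormedSpace.exp (t • X)))).comp_hasDerivAt t hm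
  simp only [rotEntry_mul, hV]
  have hA : rotEntry U b (NormedSpace.exp (t • X) * (Complex.I • ((H : Matrix n n ℂ) * A - A * H)) *
      (NormedSpace.exp (t • X)).conjTranspose) =
      rotEntry U b (NormedSpace.exp (t • X) * X * A * star (NormedSpace.exp (t • X)) +
        NormedSpace.exp (t • X) * A * star (NormedSpace.exp (t • X) * X)) := by
    rw [star_mul, hXs, Matrix.star_eq_conjTranspose]
    congr 1
    rw [hX]
    simp only [sub_eq_add_neg, mul_add, add_mul, smul_add, smul_neg, mul_assoc, mul_neg, neg_mul,
      smul_mul_assoc, mul_smul_comm]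
  rw [hA]
  exact hL

end

/-- By right invariance the moment is constant along `U ↦ U * V s`. Differentiating under the
integral at `s = 0` gives a Leibniz rule whose total vanishes. -/
lemma haarMoment_commutator_selfAdjoint (b : n) (H : selfAdjoint (Matrix n n ℂ))
    (A B C : Matrix n n ℂ) :
    haarMoment b (Complex.I • ((H : Matrix n n ℂ) * A - A * H)) B C +
      haarMoment b A (Complex.I • ((H : Matrix n n ℂ) * B - B * H)) C +
      haarMoment b A B (Complex.I • ((H : Matrix n n ℂ) * C - C * H)) = 0 := by
  obtain ⟨V, hV0, hV⟩ := exists_unitary_path H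
  set δ : Matrix n n ℂ → Matrix n n ℂ := fun A => Complex.I • ((H : Matrix n n ℂ) * A - A * H)
  set G : Matrix.unitaryGroup n ℂ → ℂ := fun U =>
    (rotEntry U b (δ A) * rotEntry U b B + rotEntry U b A * rotEntry U b (δ B)) * rotEntry U b C
      + rotEntry U b A * rotEntry U b B * rotEntry U b (δ C) with hG
  have hc := continuous_rotEntry (n := n) b
  have hGc : Continuous G := by
    have := hc A; have := hc B; have := hc C
    have := hc (δ A); have := hc (δ B); have := hc (δ C)
    fun_prop
  have hfc : Continuous fun U => rotEntry U b A * rotEntry U b B * rotEntry U b C := by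
    have := hc A; have := hc B; have := hc C
    fun_prop
  -- The derivative at parameter `s` is `G (U * V s)`, so one bound for `G` on the compact group
  -- dominates it for all `s`.
  obtain ⟨K, hK⟩ : ∃ K, ∀ U, ‖G U‖ ≤ K := by
    obtain ⟨K, hK⟩ := isCompact_univ.exists_bound_of_continuousOn hGc.continuousOn
    exact ⟨K, fun U => hK U trivial⟩
  have key := hasDerivAt_integral_of_dominated_loc_of_deriv_le (μ := haarUnitary n) (x₀ := (0 : ℝ))
    (F := fun s U => rotEntry (U * V s) b A * rotEntry (U * V s) b B * rotEntry (U * V s) b C)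
    (F' := fun s U => G (U * V s)) (bound := fun _ => K) Filter.univ_mem
    (Filter.Eventually.of_forall fun s =>
      (integrable_of_continuous (hfc.comp (continuous_mul_const (V s)))).aestronglyMeasurable)
    (integrable_of_continuous (hfc.comp (continuous_mul_const (V 0))))
    (integrable_of_continuous (hGc.comp (continuous_mul_const (V 0)))).aestronglyMeasurable
    (Filter.Eventually.of_forall fun U s _ => hK _) (integrable_const K)
    (Filter.Eventually.of_forall fun U s _ => ((hV U b A s).mul (hV U b B s)).mul (hV U b C s))
  have hconst : ∀ s, ∫ U, rotEntry (U * V s) b A * rotEntry (U * V s) b B * rotEntry (U * V s) b C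
      ∂(haarUnitary n) = haarMoment b A B C := fun s =>
    integral_mul_right_eq_self
      (fun U => rotEntry U b A * rotEntry U b B * rotEntry U b C) (V s)
  have h0 : ∫ U, G (U * V 0) ∂(haarUnitary n) = 0 := by
    have := key.2
    simp only [hconst] at this
    exact this.unique (hasDerivAt_const _ _)
  rw [hV0] at h0
  simp only [mul_one, hG, add_mul] at h0
  have hi : ∀ A B C, Integrable (fun U => rotEntry U b A * rotEntry U b B * rotEntry U b C)
      (haarUnitary n) := fun A B C => integrable_of_continuous (by
    have := hc A; have := hc B; have := hc C
    fun_prop)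
  have h12 : Integrable (fun U => rotEntry U b (δ A) * rotEntry U b B * rotEntry U b C +
      rotEntry U b A * rotEntry U b (δ B) * rotEntry U b C) (haarUnitary n) :=
    (hi _ _ _).add (hi _ _ _)
  rw [integral_add h12 (hi _ _ _), integral_add (hi _ _ _) (hi _ _ _)] at h0
  exact h0

lemma integrable_rotEntry_mul (μ : Measure (Matrix.unitaryGroup n ℂ)) [IsFiniteMeasure μ] (b : n)
    (A B C : Matrix n n ℂ) :
    Integrable (fun U => rotEntry U b A * rotEntry U b B * rotEntry U b C) μ :=
  integrable_of_continuous
    (((continuous_rotEntry b A).mul (continuous_rotEntry b B)).mul (continuous_rotEntry b C))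

/-- The Haar average as a linear functional of its first argument. -/
def haarMomentLin (b : n) (B C : Matrix n n ℂ) : Matrix n n ℂ →ₗ[ℂ] ℂ where
  toFun A := haarMoment b A B C
  map_add' A A' := by
    simp only [haarMoment, map_add, add_mul]
    exact integral_add (integrable_rotEntry_mul _ b A B C) (integrable_rotEntry_mul _ b A' B C)
  map_smul' c A := by
    simp only [haarMoment, map_smul, smul_mul_assoc, integral_smul, RingHom.id_apply]

lemma haarMomentLin_apply (b : n) (A B C : Matrix n n ℂ) :
    haarMomentLin b B C A = haarMoment b A B C := rfl

lemma haarMoment_swap (b : n) (A B C : Matrix n n ℂ) :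
    haarMoment b A B C = haarMoment b B A C := by
  simp only [haarMoment, mul_comm]

lemma haarMoment_swap' (b : n) (A B C : Matrix n n ℂ) :
    haarMoment b A B C = haarMoment b A C B := by
  simp only [haarMoment, mul_right_comm]

lemma haarMoment_rotate (b : n) (A B C : Matrix n n ℂ) :
    haarMoment b A B C = haarMoment b C A B := by
  rw [haarMoment_swap', haarMoment_swap]

/-- The identity is complex linear in `X`, so it extends from self-adjoint matrices through real and
imaginary parts. -/
lemma haarMoment_commutator (b : n) (X A B C : Matrix n n ℂ) :
    haarMoment b (X * A - A * X) B C + haarMoment b A (X * B - B * X) C +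
      haarMoment b A B (X * C - C * X) = 0 := by
  have key : ∀ H : selfAdjoint (Matrix n n ℂ),
      haarMoment b ((H : Matrix n n ℂ) * A - A * H) B C +
      haarMoment b A ((H : Matrix n n ℂ) * B - B * H) C +
      haarMoment b A B ((H : Matrix n n ℂ) * C - C * H) = 0 := by
    intro H
    have h := haarMoment_commutator_selfAdjoint b H A B C
    -- The moment is symmetric; moving each commutator to the first slot makes `haarMomentLin`
    -- applicable to it.
    rw [haarMoment_swap b A, haarMoment_rotate b A B] at h ⊢
    simp only [← haarMomentLin_apply, map_smul, smul_eq_mul, ← mul_add] at h ⊢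
    exact (mul_eq_zero.1 h).resolve_left Complex.I_ne_zero
  have h1 := key (realPart X)
  have h2 := key (imaginaryPart X)
  rw [haarMoment_swap b A, haarMoment_rotate b A B] at h1 h2 ⊢
  simp only [← haarMomentLin_apply] at h1 h2 ⊢
  have hd : ∀ Y : Matrix n n ℂ, X * Y - Y * X =
      ((realPart X : Matrix n n ℂ) * Y - Y * (realPart X : Matrix n n ℂ)) +
      Complex.I • ((imaginaryPart X : Matrix n n ℂ) * Y -
        Y * (imaginaryPart X : Matrix n n ℂ)) := by
    intro Y
    conv_lhs => rw [← realPart_add_I_smul_imaginaryPart X]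
    simp only [add_mul, mul_add, smul_mul_assoc, mul_smul_comm, smul_sub]
    abel
  simp only [hd, map_add, map_smul, smul_eq_mul]
  linear_combination h1 + Complex.I * h2

lemma rotEntry_eq_sum (U : Matrix.unitaryGroup n ℂ) (b : n) (A : Matrix n n ℂ) :
    rotEntry U b A = ∑ x, ∑ y, (U : Matrix n n ℂ) b x * A x y * star ((U : Matrix n n ℂ) b y) := by
  simp only [rotEntry_apply, Matrix.mul_apply, Matrix.conjTranspose_apply, Finset.sum_mul]
  exact Finset.sum_comm

lemma sum_mul_star_unitary (U : Matrix.unitaryGroup n ℂ) (b : n) :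
    ∑ l, (U : Matrix n n ℂ) b l * star ((U : Matrix n n ℂ) b l) = 1 := by
  have := congr_fun (congr_fun (unitary_mul_conjTranspose U) b) b
  simpa [Matrix.mul_apply] using this

lemma rotEntry_single (U : Matrix.unitaryGroup n ℂ) (b i l : n) :
    rotEntry U b (Matrix.single i l 1) =
      (U : Matrix n n ℂ) b i * star ((U : Matrix n n ℂ) b l) := by
  rw [rotEntry_eq_sum, Finset.sum_eq_single i, Finset.sum_eq_single l] <;>
    simp +contextual [Matrix.single_apply, eq_comm]

lemma rotEntry_single_mul (U : Matrix.unitaryGroup n ℂ) (b l q : n) (B : Matrix n n ℂ) :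
    rotEntry U b (Matrix.single l q 1 * B) =
      (U : Matrix n n ℂ) b l * ∑ y, B q y * star ((U : Matrix n n ℂ) b y) := by
  rw [rotEntry_eq_sum, Finset.sum_eq_single l]
  · simp [Finset.mul_sum, mul_assoc]
  · intro x _ hx
    simp [hx]
  · simp

lemma rotEntry_mul_single (U : Matrix.unitaryGroup n ℂ) (b l q : n) (B : Matrix n n ℂ) :
    rotEntry U b (B * Matrix.single l q 1) =
      (∑ x, (U : Matrix n n ℂ) b x * B x l) * star ((U : Matrix n n ℂ) b q) := by
  rw [rotEntry_eq_sum, Finset.sum_mul]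
  refine Finset.sum_congr rfl fun x _ => ?_
  rw [Finset.sum_eq_single q]
  · simp
  · intro y _ hy
    simp [hy]
  · simp

/-- The entry of a matrix unit factors as `U b i * star (U b l)`, so the sum over `l` isolates the
squared norm of row `b`, which is 1. -/
lemma sum_rotEntry_single_mul (U : Matrix.unitaryGroup n ℂ) (b i q : n) (B : Matrix n n ℂ) :
    ∑ l, rotEntry U b (Matrix.single i l 1) * rotEntry U b (Matrix.single l q 1 * B) =
      rotEntry U b (Matrix.single i q 1 * B) := by
  simp only [rotEntry_single, rotEntry_single_mul]
  calc _ = ((U : Matrix n n ℂ) b i * ∑ y, B q y * star ((U : Matrix n n ℂ) b y)) *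
        ∑ l, (U : Matrix n n ℂ) b l * star ((U : Matrix n n ℂ) b l) := by
        rw [Finset.mul_sum (s := Finset.univ) (f := fun l => (U : Matrix n n ℂ) b l * _)]
        exact Finset.sum_congr rfl fun l _ => by ring
    _ = _ := by rw [sum_mul_star_unitary, mul_one]

/-- With the matrix unit on the right, the sum over `l` reassembles the full entry of `B` and leaves
a product of two entries. -/
lemma sum_rotEntry_mul_single (U : Matrix.unitaryGroup n ℂ) (b i q : n) (B : Matrix n n ℂ) :
    ∑ l, rotEntry U b (Matrix.single i l 1) * rotEntry U b (B * Matrix.single l q 1) =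
      rotEntry U b (Matrix.single i q 1) * rotEntry U b B := by
  simp only [rotEntry_single, rotEntry_mul_single]
  rw [rotEntry_eq_sum, Finset.sum_comm, Finset.mul_sum]
  refine Finset.sum_congr rfl fun l _ => ?_
  rw [Finset.sum_mul, Finset.mul_sum, Finset.mul_sum]
  exact Finset.sum_congr rfl fun x _ => by ring

lemma sum_haarMoment_commutator (b i q : n) (B C : Matrix n n ℂ) :
    ∑ l, haarMoment b (Matrix.single i l 1)
      (Matrix.single l q 1 * B - B * Matrix.single l q 1) C =
      haarMoment b 1 (Matrix.single i q 1 * B) C - haarMoment b (Matrix.single i q 1) B C := by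
  simp only [haarMoment]
  rw [← integral_finsetSum _ fun l _ => integrable_rotEntry_mul _ b _ _ _,
    ← integral_sub (integrable_rotEntry_mul _ b _ _ _) (integrable_rotEntry_mul _ b _ _ _)]
  refine integral_congr_ae (Filter.Eventually.of_forall fun U => ?_)
  simp only
  rw [← Finset.sum_mul, ← sub_mul, rotEntry_one, one_mul, ← sum_rotEntry_single_mul U b i q B,
    ← sum_rotEntry_mul_single, ← Finset.sum_sub_distrib]
  simp only [map_sub, mul_sub]

/-- Summing the commutator identity for `X = E_lq`, `A = E_il` over `l` acts like a Casimir
operator. Its first term returns the moment `-card n` times, the other two return it `-1` times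
each, and in everything else the first argument has become `1`, which lowers the degree. -/
lemma haarMoment_single_recursion (b i q : n) (B C : Matrix n n ℂ) :
    ((Fintype.card n : ℂ) + 2) * haarMoment b (Matrix.single i q 1) B C =
      (Matrix.single i q (1 : ℂ)).trace * haarMoment b 1 B C +
        haarMoment b 1 (Matrix.single i q 1 * B) C +
        haarMoment b 1 B (Matrix.single i q 1 * C) := by
  have h := Finset.sum_eq_zero (s := Finset.univ) fun l _ =>
    haarMoment_commutator b (Matrix.single l q (1 : ℂ)) (Matrix.single i l 1) B C
  rw [Finset.sum_add_distrib, Finset.sum_add_distrib, sum_haarMoment_commutator] at h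
  simp only [haarMoment_swap' b _ B] at h ⊢
  rw [sum_haarMoment_commutator] at h
  have h1 : ∑ l, haarMoment b (Matrix.single l q 1 * Matrix.single i l 1 -
      Matrix.single i l 1 * Matrix.single l q 1) C B =
      (Matrix.single i q (1 : ℂ)).trace * haarMoment b 1 C B -
        (Fintype.card n : ℂ) * haarMoment b (Matrix.single i q 1) C B := by
    simp only [← haarMomentLin_apply, map_sub, Finset.sum_sub_distrib, ← map_sum]
    congr 1
    · by_cases hiq : i = q
      · subst hiq
        have : ∑ l, Matrix.single l i (1 : ℂ) * Matrix.single i l 1 = (1 : Matrix n n ℂ) := by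
          simp only [Matrix.single_mul_single_same, mul_one]
          exact Matrix.sum_single_one
        rw [this]; simp
      · simp [Matrix.single_mul_single_of_ne _ _ _ _ (Ne.symm hiq), hiq]
    · simp only [Matrix.single_mul_single_same, mul_one, Finset.sum_const, Finset.card_univ]
      rw [map_nsmul, nsmul_eq_mul]
  rw [h1] at h
  linear_combination -h

/-- Both sides are linear in `A`, so matrix units suffice. Iterating this recursion evaluates the
moments of degree one, two and three in turn. -/
lemma haarMoment_recursion (b : n) (A B C : Matrix n n ℂ) :
    ((Fintype.card n : ℂ) + 2) * haarMoment b A B C =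
      A.trace * haarMoment b 1 B C + haarMoment b 1 (A * B) C + haarMoment b 1 B (A * C) := by
  let f : Matrix n n ℂ →ₗ[ℂ] ℂ := ((Fintype.card n : ℂ) + 2) • haarMomentLin b B C
  let g : Matrix n n ℂ →ₗ[ℂ] ℂ := haarMoment b 1 B C • Matrix.traceLinearMap n ℂ ℂ +
    haarMomentLin b 1 C ∘ₗ LinearMap.mulRight ℂ B + haarMomentLin b 1 B ∘ₗ LinearMap.mulRight ℂ C
  have hfg : f = g := by
    refine (Matrix.stdBasis ℂ n n).ext fun ⟨i, q⟩ => ?_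
    rw [Matrix.stdBasis_eq_single]
    have := haarMoment_single_recursion b i q B C
    simp only [f, g, LinearMap.smul_apply, LinearMap.add_apply, LinearMap.comp_apply,
      LinearMap.mulRight_apply, haarMomentLin_apply, smul_eq_mul, Matrix.traceLinearMap_apply]
    rw [this, haarMoment_swap b 1 (_ * B), haarMoment_rotate b 1 B (_ * C)]
    ring
  have := LinearMap.congr_fun hfg A
  simp only [f, g, LinearMap.smul_apply, LinearMap.add_apply, LinearMap.comp_apply,
      LinearMap.mulRight_apply, haarMomentLin_apply, smul_eq_mul,
      Matrix.traceLinearMap_apply] at this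
  rw [this, haarMoment_swap b 1 (_ * B), haarMoment_rotate b 1 B (_ * C)]
  ring

lemma haarMoment_one_one_one (b : n) : haarMoment b (1 : Matrix n n ℂ) 1 1 = 1 := by
  simp [haarMoment, rotEntry_one]

lemma card_mul_haarMoment (b : n) (A : Matrix n n ℂ) :
    (Fintype.card n : ℂ) * haarMoment b 1 1 A = A.trace := by
  have h := haarMoment_recursion b A 1 1
  rw [haarMoment_one_one_one, mul_one A, haarMoment_swap b 1 A 1] at h
  rw [haarMoment_rotate b 1 1 A] at h ⊢
  linear_combination h

lemma card_mul_haarMoment_two (b : n) (A B : Matrix n n ℂ) :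
    (Fintype.card n : ℂ) * (Fintype.card n + 1) * haarMoment b 1 A B =
      A.trace * B.trace + (A * B).trace := by
  have h := haarMoment_recursion b A B 1
  have h1 := card_mul_haarMoment b B
  have h2 := card_mul_haarMoment b (A * B)
  rw [mul_one A, haarMoment_swap' b 1 B 1, haarMoment_swap' b 1 (A * B) 1,
    haarMoment_swap' b 1 B A, haarMoment_rotate b A B 1] at h
  linear_combination (Fintype.card n : ℂ) * h + A.trace * h1 + h2

theorem card_mul_haarMoment_three (b : n) (A B C : Matrix n n ℂ) :
    (Fintype.card n : ℂ) * (Fintype.card n + 1) * (Fintype.card n + 2) * haarMoment b A B C =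
      A.trace * (B.trace * C.trace + (B * C).trace) +
        ((A * B).trace * C.trace + (A * B * C).trace) +
        (B.trace * (A * C).trace + (B * (A * C)).trace) := by
  have h := haarMoment_recursion b A B C
  have h1 := card_mul_haarMoment_two b B C
  have h2 := card_mul_haarMoment_two b (A * B) C
  have h3 := card_mul_haarMoment_two b B (A * C)
  linear_combination (Fintype.card n : ℂ) * (Fintype.card n + 1) * h + A.trace * h1 + h2 + h3

end Haar

/-! ### Hilbert–Schmidt norm inequalities -/

section Frobenius

variable {m n : Type*} [Fintype m] [Fintype n]

/-- The squared Hilbert–Schmidt norm. -/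
def frobSq (A : Matrix m n ℂ) : ℝ := ∑ i, ∑ j, ‖A i j‖ ^ 2

lemma frobSq_nonneg (A : Matrix m n ℂ) : 0 ≤ frobSq A := by
  unfold frobSq; positivity

lemma frobSq_conjTranspose (A : Matrix m n ℂ) : frobSq A.conjTranspose = frobSq A := by
  unfold frobSq
  rw [Finset.sum_comm]
  simp

lemma trace_mul_conjTranspose (A : Matrix m n ℂ) :
    (A * A.conjTranspose).trace = (frobSq A : ℂ) := by
  simp [frobSq, Matrix.trace, Matrix.mul_apply, Complex.mul_conj, Complex.normSq_eq_norm_sq]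

lemma trace_conjTranspose_mul (A : Matrix m n ℂ) :
    (A.conjTranspose * A).trace = (frobSq A : ℂ) := by
  rw [Matrix.trace_mul_comm, trace_mul_conjTranspose]

lemma norm_sum_mul_sq_le {ι : Type*} (s : Finset ι) (f g : ι → ℂ) :
    ‖∑ i ∈ s, f i * g i‖ ^ 2 ≤ (∑ i ∈ s, ‖f i‖ ^ 2) * ∑ i ∈ s, ‖g i‖ ^ 2 := by
  calc ‖∑ i ∈ s, f i * g i‖ ^ 2 ≤ (∑ i ∈ s, ‖f i‖ * ‖g i‖) ^ 2 := by
        gcongr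
        exact (norm_sum_le _ _).trans_eq (Finset.sum_congr rfl fun i _ => norm_mul _ _)
    _ ≤ _ := Finset.sum_mul_sq_le_sq_mul_sq _ _ _

lemma norm_trace_mul_sq_le (A : Matrix m n ℂ) (B : Matrix n m ℂ) :
    ‖(A * B).trace‖ ^ 2 ≤ frobSq A * frobSq B := by
  have h := norm_sum_mul_sq_le (Finset.univ : Finset (m × n)) (fun p => A p.1 p.2)
    (fun p => B p.2 p.1)
  rw [Fintype.sum_prod_type, Fintype.sum_prod_type, Fintype.sum_prod_type_right] at h
  simpa [Matrix.trace, Matrix.mul_apply, frobSq] using h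

lemma frobSq_mul_le {l : Type*} [Fintype l] (A : Matrix l m ℂ) (B : Matrix m n ℂ) :
    frobSq (A * B) ≤ frobSq A * frobSq B := by
  unfold frobSq
  rw [Finset.sum_comm (f := fun i j => ‖B i j‖ ^ 2), Finset.sum_mul]
  refine Finset.sum_le_sum fun i _ => ?_
  rw [Finset.mul_sum]
  exact Finset.sum_le_sum fun j _ => norm_sum_mul_sq_le _ _ _

lemma frobSq_one [DecidableEq n] : frobSq (1 : Matrix n n ℂ) = Fintype.card n := by
  have := trace_mul_conjTranspose (1 : Matrix n n ℂ)
  simp only [Matrix.conjTranspose_one, mul_one, Matrix.trace_one] at this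
  exact_mod_cast this.symm

lemma norm_trace_sq_le [DecidableEq n] (A : Matrix n n ℂ) :
    ‖A.trace‖ ^ 2 ≤ Fintype.card n * frobSq A := by
  simpa [frobSq_one, mul_comm] using norm_trace_mul_sq_le A (1 : Matrix n n ℂ)

section
open scoped MatrixOrder Matrix.Norms.L2Operator

lemma exists_eq_conjTranspose_mul_self {A : Matrix n n ℂ} (hA : A.PosSemidef) :
    ∃ B : Matrix n n ℂ, A = B.conjTranspose * B := by
  classical
  exact CStarAlgebra.nonneg_iff_eq_star_mul_self.mp hA.nonneg

end

/-- Factor `ρ = B†B`: then `‖B‖² = Tr ρ = 1`, and submultiplicativity concludes without any spectral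
decomposition. -/
lemma IsState.frobSq_le_one {ρ : Matrix n n ℂ} (hρ : IsState ρ) : frobSq ρ ≤ 1 := by
  obtain ⟨B, hB⟩ := exists_eq_conjTranspose_mul_self hρ.1
  have h1 : frobSq B = 1 := by
    have := hρ.2
    rw [hB, trace_conjTranspose_mul] at this
    exact_mod_cast this
  calc frobSq ρ ≤ frobSq B.conjTranspose * frobSq B := hB ▸ frobSq_mul_le _ _
    _ = 1 := by rw [frobSq_conjTranspose, h1, one_mul]

end Frobenius

/-! ### Mean and second moment of a single run -/

section Run

variable {n : Type*} [Fintype n] [DecidableEq n]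

/-- The product of the three entries is the `(bbb, bbb)` entry of the twirl of `A ⊗ B ⊗ C`. -/
lemma IsUnitaryDesign.integral_rotEntry {ν : Measure (Matrix.unitaryGroup n ℂ)}
    (hν : IsUnitaryDesign 3 ν) (b : n) (A B C : Matrix n n ℂ) :
    ∫ U, rotEntry U b A * rotEntry U b B * rotEntry U b C ∂ν = haarMoment b A B C := by
  let T : Fin 3 → Matrix n n ℂ := ![A, B, C]
  have key : ∀ U : Matrix.unitaryGroup n ℂ,
      (tensorPower 3 (U : Matrix n n ℂ) * Matrix.of (fun i j : Fin 3 → n => ∏ s, T s (i s) (j s)) *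
        (tensorPower 3 (U : Matrix n n ℂ)).conjTranspose) (fun _ => b) (fun _ => b) =
      rotEntry U b A * rotEntry U b B * rotEntry U b C := by
    intro U
    have h1 : rotEntry U b A * rotEntry U b B * rotEntry U b C = ∏ s, rotEntry U b (T s) := by
      simp [Fin.prod_univ_three, T]
    rw [h1]
    simp only [rotEntry_apply, Matrix.mul_apply, tensorPower, Matrix.of_apply,
      Matrix.conjTranspose_apply]
    rw [Finset.prod_univ_sum, Fintype.piFinset_univ]
    refine Finset.sum_congr rfl fun j _ => ?_
    rw [Finset.prod_mul_distrib, Finset.prod_univ_sum, Fintype.piFinset_univ, star_prod]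
    simp only [Finset.prod_mul_distrib]
  have := hν (Matrix.of (fun i j : Fin 3 → n => ∏ s, T s (i s) (j s))) (fun _ => b) (fun _ => b)
  simp only [key] at this
  exact this

lemma outcomeProb_coe {ρ : Matrix n n ℂ} (hρ : ρ.IsHermitian) (U : Matrix.unitaryGroup n ℂ)
    (b : n) :
    (outcomeProb ρ U b : ℂ) = rotEntry U b ρ := by
  have h := rotEntry_conjTranspose U b ρ
  rw [hρ.eq] at h
  exact Complex.conj_eq_iff_re.1 h.symm

lemma outcomeProb_nonneg {ρ : Matrix n n ℂ} (hρ : ρ.PosSemidef) (U : Matrix.unitaryGroup n ℂ)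
    (b : n) :
    0 ≤ outcomeProb ρ U b := by
  have h := (hρ.mul_mul_conjTranspose_same (U : Matrix n n ℂ)).diag_nonneg (i := b)
  exact (Complex.le_def.1 h).1

lemma continuous_outcomeProb (ρ : Matrix n n ℂ) (b : n) :
    Continuous fun U => outcomeProb ρ U b :=
  Complex.continuous_re.comp (continuous_rotEntry b ρ)

/-- The identity has rotated entry 1, so the `-I` in the shadow can be absorbed into the observable.
Estimates thereby become single diagonal entries, to which the moment formulas apply. -/
lemma trace_shadow_mul (U : Matrix.unitaryGroup n ℂ) (b : n) (A : Matrix n n ℂ) :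
    (shadow (U, b) * A).trace =
      rotEntry U b (((Fintype.card n : ℂ) + 1) • A - A.trace • (1 : Matrix n n ℂ)) := by
  rw [map_sub, map_smul, map_smul, rotEntry_one, shadow, sub_mul, Matrix.trace_sub, one_mul,
    smul_mul_assoc, Matrix.trace_smul, mul_assoc, mul_assoc, Matrix.trace_mul_comm, mul_assoc,
    Matrix.trace_single_mul, rotEntry_apply, mul_assoc]
  simp

lemma sum_rotEntry (U : Matrix.unitaryGroup n ℂ) (A : Matrix n n ℂ) :
    ∑ b, rotEntry U b A = A.trace := by
  have h : ∑ b, rotEntry U b A =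
      ((U : Matrix n n ℂ) * A * (U : Matrix n n ℂ).conjTranspose).trace := rfl
  rw [h, Matrix.trace_mul_comm, ← mul_assoc,
    ← Matrix.star_eq_conjTranspose, Matrix.mem_unitaryGroup_iff'.1 U.2, one_mul]

/-- The observable whose rotated diagonal entry is the shadow estimate of `A`. -/
def liftObs (A : Matrix n n ℂ) : Matrix n n ℂ :=
  ((Fintype.card n : ℂ) + 1) • A - A.trace • (1 : Matrix n n ℂ)

lemma trace_liftObs (A : Matrix n n ℂ) : (liftObs A).trace = A.trace := by
  simp [liftObs, Matrix.trace_sub, Matrix.trace_smul, Matrix.trace_one]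
  ring

lemma frobSq_liftObs (A : Matrix n n ℂ) :
    frobSq (liftObs A) =
      (Fintype.card n + 1) ^ 2 * frobSq A - (Fintype.card n + 2) * ‖A.trace‖ ^ 2 := by
  have h : ((frobSq (liftObs A) : ℝ) : ℂ) =
      (((Fintype.card n + 1) ^ 2 * frobSq A - (Fintype.card n + 2) * ‖A.trace‖ ^ 2 : ℝ) : ℂ) := by
    have hn : ((‖A.trace‖ ^ 2 : ℝ) : ℂ) = A.trace * star A.trace := by
      rw [Complex.star_def, Complex.mul_conj, Complex.normSq_eq_norm_sq]
    rw [Complex.ofReal_sub, Complex.ofReal_mul _ (‖A.trace‖ ^ 2), hn, Complex.ofReal_mul,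
      ← trace_mul_conjTranspose, ← trace_mul_conjTranspose]
    simp only [liftObs, Matrix.conjTranspose_sub, Matrix.conjTranspose_smul,
      Matrix.conjTranspose_one, sub_mul, mul_sub, smul_mul_assoc, mul_smul_comm, mul_one, one_mul,
      Matrix.trace_sub, Matrix.trace_smul, Matrix.trace_one, Matrix.trace_conjTranspose,
      smul_eq_mul]
    simp
    ring
  exact_mod_cast h

lemma card_pos_of_isState {n : Type*} [Fintype n] {ρ : Matrix n n ℂ} (hρ : IsState ρ) :
    0 < Fintype.card n := by
  rw [Fintype.card_pos_iff]
  by_contra h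
  rw [not_nonempty_iff] at h
  have := hρ.2
  simp [Matrix.trace] at this

/-- Second countability makes open sets of finite products of run spaces measurable for the product
σ-algebra. -/
instance : SecondCountableTopology (Matrix.unitaryGroup n ℂ) :=
  haveI : SecondCountableTopology (Matrix n n ℂ) :=
    inferInstanceAs (SecondCountableTopology (n → n → ℂ))
  TopologicalSpace.Subtype.secondCountableTopology _

variable [TopologicalSpace n] [DiscreteTopology n]

lemma continuous_shadow : Continuous (shadow : Matrix.unitaryGroup n ℂ × n → Matrix n n ℂ) := by
  rw [continuous_prod_of_discrete_right]
  intro b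
  have h : Continuous fun U : Matrix.unitaryGroup n ℂ => (U : Matrix n n ℂ) :=
    continuous_subtype_val
  have h1 : Continuous fun U : Matrix.unitaryGroup n ℂ =>
      (U : Matrix n n ℂ).conjTranspose * Matrix.single b b 1 * (U : Matrix n n ℂ) :=
    (h.matrix_conjTranspose.matrix_mul continuous_const).matrix_mul h
  have h2 := h1.const_smul ((Fintype.card n : ℂ) + 1)
  exact h2.sub (continuous_const (y := (1 : Matrix n n ℂ)))

variable [MeasurableSpace n] [OpensMeasurableSpace n]

/-- The outcome density is the diagonal entry of `ρ`, so it raises the degree by one: means of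
estimates are moments of degree two and their second moments are of degree three. -/
lemma integral_runLaw {ν : Measure (Matrix.unitaryGroup n ℂ)} [IsProbabilityMeasure ν]
    {ρ : Matrix n n ℂ} (hρ : ρ.PosSemidef) {f : Matrix.unitaryGroup n ℂ × n → ℂ}
    (hf : Continuous f) :
    ∫ x, f x ∂(runLaw ν ρ) = ∑ b, ∫ U, rotEntry U b ρ * f (U, b) ∂ν := by
  have hm : ∀ b : n, Measurable fun U : Matrix.unitaryGroup n ℂ => (U, b) := fun b =>
    measurable_id.prodMk measurable_const
  have hfin : ∀ b : n, IsFiniteMeasure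
      (ν.withDensity fun U => ENNReal.ofReal (outcomeProb ρ U b)) := fun b =>
    isFiniteMeasure_withDensity_ofReal (integrable_of_continuous (continuous_outcomeProb ρ b)).2
  rw [runLaw, integral_finsetSum_measure]
  · refine Finset.sum_congr rfl fun b _ => ?_
    rw [integral_map (hm b).aemeasurable hf.aestronglyMeasurable,
      integral_withDensity_eq_integral_toReal_smul
        (continuous_outcomeProb ρ b).measurable.ennreal_ofReal (by simp)]
    refine integral_congr_ae (Filter.Eventually.of_forall fun U => ?_)
    simp only [ENNReal.toReal_ofReal (outcomeProb_nonneg hρ U b), Complex.real_smul,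
      outcomeProb_coe hρ.1]
  · intro b _
    exact integrable_of_continuous hf

lemma isProbabilityMeasure_runLaw {ν : Measure (Matrix.unitaryGroup n ℂ)} [IsProbabilityMeasure ν]
    {ρ : Matrix n n ℂ} (hρ : IsState ρ) : IsProbabilityMeasure (runLaw ν ρ) := by
  have hfin : ∀ b : n, IsFiniteMeasure
      (ν.withDensity fun U => ENNReal.ofReal (outcomeProb ρ U b)) := fun b =>
    isFiniteMeasure_withDensity_ofReal (integrable_of_continuous (continuous_outcomeProb ρ b)).2
  have : IsFiniteMeasure (runLaw ν ρ) := by unfold runLaw; infer_instance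
  have h := integral_runLaw (ν := ν) hρ.1 (f := fun _ => 1) continuous_const
  simp only [mul_one] at h
  rw [← integral_finsetSum _ fun b _ => integrable_of_continuous (continuous_rotEntry b ρ)] at h
  simp only [sum_rotEntry, hρ.2] at h
  simp only [integral_const, probReal_univ, one_smul, Complex.real_smul, mul_one] at h
  exact isProbabilityMeasure_iff_real.2 (by exact_mod_cast h)

variable {ν : Measure (Matrix.unitaryGroup n ℂ)} [IsProbabilityMeasure ν] {ρ : Matrix n n ℂ}

theorem integral_trace_shadow_mul (hρ : IsState ρ) (hν : IsUnitaryDesign 3 ν) (A : Matrix n n ℂ) :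
    ∫ x, (shadow x * A).trace ∂(runLaw ν ρ) = (ρ * A).trace := by
  have hN : (Fintype.card n : ℂ) ≠ 0 := by exact_mod_cast (card_pos_of_isState hρ).ne'
  have hN1 : (Fintype.card n : ℂ) + 1 ≠ 0 := Nat.cast_add_one_ne_zero _
  rw [integral_runLaw hρ.1 (continuous_shadow.matrix_mul continuous_const).matrix_trace]
  have h : ∀ b, ∫ U, rotEntry U b ρ * (shadow (U, b) * A).trace ∂ν =
      haarMoment b 1 ρ (liftObs A) := by
    intro b
    rw [← hν.integral_rotEntry]
    simp only [rotEntry_one, one_mul, trace_shadow_mul]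
    rfl
  have h2 : ∀ b, haarMoment b 1 ρ (liftObs A) =
      (ρ * A).trace / Fintype.card n := by
    intro b
    have := card_mul_haarMoment_two b ρ (liftObs A)
    rw [trace_liftObs, hρ.2] at this
    simp only [liftObs, mul_sub, Matrix.trace_sub, mul_smul_comm, Matrix.trace_smul, mul_one,
      hρ.2, smul_eq_mul] at this
    rw [eq_div_iff hN]
    apply mul_left_cancel₀ hN1
    rw [liftObs]
    linear_combination this
  simp only [h, h2, Finset.sum_const, Finset.card_univ, nsmul_eq_mul]
  field_simp

/-- The degree-three formula expresses the integral through six traces. Cauchy–Schwarz bounds them,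
and the state enters only through trace 1 and Hilbert–Schmidt norm at most 1; hence the constant
depends neither on the state nor on the dimension. -/
theorem integral_norm_trace_shadow_mul_sq_le (hρ : IsState ρ) (hν : IsUnitaryDesign 3 ν)
    (A : Matrix n n ℂ) :
    ∫ x, ‖(shadow x * A).trace‖ ^ 2 ∂(runLaw ν ρ) ≤ 4 * frobSq A := by
  have hN : (Fintype.card n : ℂ) ≠ 0 := by exact_mod_cast (card_pos_of_isState hρ).ne'
  have hN1 : (Fintype.card n : ℂ) + 1 ≠ 0 := Nat.cast_add_one_ne_zero _
  have hN2 : (Fintype.card n : ℂ) + 2 ≠ 0 := by exact_mod_cast Nat.succ_ne_zero (Fintype.card n + 1)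
  set A' := liftObs A with hA'
  set S : ℂ := (A'.trace * star A'.trace + (A' * A'.conjTranspose).trace) +
        ((ρ * A').trace * star A'.trace + (ρ * A' * A'.conjTranspose).trace) +
        (A'.trace * (ρ * A'.conjTranspose).trace + (A' * (ρ * A'.conjTranspose)).trace) with hS
  have hc := (continuous_shadow (n := n).matrix_mul (continuous_const (y := A))).matrix_trace
  have h1 : ((∫ x, ‖(shadow x * A).trace‖ ^ 2 ∂(runLaw ν ρ) : ℝ) : ℂ) *
      ((Fintype.card n + 1) * (Fintype.card n + 2)) = S := by
    have h : ∀ b, ∫ U, rotEntry U b ρ *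
        ((‖(shadow (U, b) * A).trace‖ ^ 2 : ℝ) : ℂ) ∂ν = haarMoment b ρ A' A'.conjTranspose := by
      intro b
      rw [← hν.integral_rotEntry]
      refine integral_congr_ae (Filter.Eventually.of_forall fun U => ?_)
      simp only [rotEntry_conjTranspose, trace_shadow_mul]
      rw [← Complex.normSq_eq_norm_sq, ← Complex.mul_conj, mul_assoc]
      rfl
    have h2 : ∀ b, haarMoment b ρ A' A'.conjTranspose =
        S / (Fintype.card n * ((Fintype.card n + 1) * (Fintype.card n + 2))) := by
      intro b
      have := card_mul_haarMoment_three b ρ A' A'.conjTranspose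
      rw [hρ.2, one_mul, Matrix.trace_conjTranspose, ← hS] at this
      rw [eq_div_iff (by simp [hN, hN1, hN2]), ← this]
      ring
    rw [← integral_complex_ofReal, integral_runLaw hρ.1
      (f := fun x => ((‖(shadow x * A).trace‖ ^ 2 : ℝ) : ℂ))
      (Complex.continuous_ofReal.comp (hc.norm.pow 2))]
    simp only [h, h2, Finset.sum_const, Finset.card_univ, nsmul_eq_mul]
    field_simp
  have hT : A'.trace = A.trace := trace_liftObs A
  have hF : frobSq A' = _ := frobSq_liftObs A
  have hρ1 := hρ.frobSq_le_one
  have hρ0 := frobSq_nonneg ρ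
  have hA0 := frobSq_nonneg A
  have hA'0 := frobSq_nonneg A'
  set f := frobSq A with hf
  set g := frobSq A' with hg
  set τ := ‖A.trace‖ with hτ
  have hτN : τ ^ 2 ≤ Fintype.card n * f := norm_trace_sq_le A
  have e1 : ∀ X : Matrix n n ℂ, frobSq X = g → ‖(ρ * X).trace‖ ≤ Real.sqrt g := by
    intro X hX
    refine Real.le_sqrt_of_sq_le ((norm_trace_mul_sq_le ρ X).trans ?_)
    rw [hX]; nlinarith
  have e2 : ∀ X Y : Matrix n n ℂ, frobSq X = g → frobSq Y = g → ‖(ρ * (X * Y)).trace‖ ≤ g := by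
    intro X Y hX hY
    refine abs_le_of_sq_le_sq' ?_ hA'0 |>.2
    refine (norm_trace_mul_sq_le ρ _).trans ?_
    have := frobSq_mul_le X Y
    rw [hX, hY] at this
    nlinarith [frobSq_nonneg (X * Y)]
  have hgs := Real.sq_sqrt hA'0
  have hgs0 := Real.sqrt_nonneg g
  have hSn : ‖S‖ ≤ τ ^ 2 + g + (Real.sqrt g * τ + g) + (τ * Real.sqrt g + g) := by
    rw [hS, hT]
    refine (norm_add₃_le).trans (add_le_add (add_le_add ?_ ?_) ?_)
    · refine (norm_add_le _ _).trans (add_le_add ?_ ?_)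
      · rw [norm_mul, norm_star, sq]
      · rw [trace_mul_conjTranspose, Complex.norm_real, Real.norm_of_nonneg (frobSq_nonneg _)]
    · refine (norm_add_le _ _).trans (add_le_add ?_ ?_)
      · rw [norm_mul, norm_star]
        exact mul_le_mul_of_nonneg_right (e1 _ rfl) (norm_nonneg _)
      · rw [mul_assoc]
        exact e2 _ _ rfl (frobSq_conjTranspose _)
    · refine (norm_add_le _ _).trans (add_le_add ?_ ?_)
      · rw [norm_mul]
        exact mul_le_mul_of_nonneg_left (e1 _ (frobSq_conjTranspose _)) (norm_nonneg _)
      · rw [Matrix.trace_mul_comm, mul_assoc]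
        exact e2 _ _ (frobSq_conjTranspose _) rfl
  set I := ∫ x, ‖(shadow x * A).trace‖ ^ 2 ∂(runLaw ν ρ) with hI
  have hI0 : 0 ≤ I := integral_nonneg fun _ => by positivity
  set N : ℝ := (Fintype.card n : ℝ) with hNdef
  have hNpos : 0 ≤ N := Nat.cast_nonneg _
  have h3 : I * ((N + 1) * (N + 2)) = ‖S‖ := by
    rw [← h1]
    have : (I : ℂ) * ((Fintype.card n + 1) * (Fintype.card n + 2)) =
        ((I * ((N + 1) * (N + 2)) : ℝ) : ℂ) := by push_cast [hNdef]; ring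
    rw [this, Complex.norm_real, Real.norm_of_nonneg (by positivity)]
  have h4 : I * ((N + 1) * (N + 2)) ≤ (4 * f) * ((N + 1) * (N + 2)) := by
    rw [h3]
    refine hSn.trans ?_
    -- By `2τ√g ≤ τ² + g` the bound is at most `4g + 2τ²`. Since `g = (N+1)²f - (N+2)τ²`, the
    -- negative part absorbs `2τ²` and leaves at most `4(N+1)²f`.
    nlinarith [sq_nonneg (Real.sqrt g - τ), mul_nonneg hNpos (sq_nonneg τ), sq_nonneg τ]
  exact le_of_mul_le_mul_right h4 (by positivity)

end Run

/-! ### Integrating out one coordinate of a product measure -/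

section Resample

variable {J : Type*} [Fintype J] [DecidableEq J] {Ω : J → Type*} [∀ j, MeasurableSpace (Ω j)]
  (P : ∀ j, Measure (Ω j)) [∀ j, IsProbabilityMeasure (P j)]

/-- Overwriting coordinate `k` by an independent copy preserves the law. This serves as conditioning
on the other coordinates, with no splitting of the index set. -/
lemma measurePreserving_update (k : J) :
    MeasurePreserving (fun p : (∀ j, Ω j) × Ω k => Function.update p.1 k p.2)
      ((Measure.pi P).prod (P k)) (Measure.pi P) := by
  have hm : Measurable (fun p : (∀ j, Ω j) × Ω k => Function.update p.1 k p.2) := measurable_update'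
  refine ⟨hm, (Measure.pi_eq fun s hs => ?_).symm⟩
  rw [Measure.map_apply hm (MeasurableSet.univ_pi hs)]
  have : (fun p : (∀ j, Ω j) × Ω k => Function.update p.1 k p.2) ⁻¹' (Set.univ.pi s) =
      (Set.univ.pi (Function.update s k Set.univ)) ×ˢ s k := by
    ext p
    simp only [Set.mem_preimage, Set.mem_pi, Set.mem_univ, true_implies, Set.mem_prod]
    constructor
    · intro h
      refine ⟨fun j => ?_, by simpa using h k⟩
      by_cases hj : j = k
      · subst hj; simp
      · simpa [hj] using h j
    · rintro ⟨h1, h2⟩ j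
      by_cases hj : j = k
      · subst hj; simpa using h2
      · simpa [hj] using h1 j
  rw [this, Measure.prod_prod, Measure.pi_pi, ← Finset.prod_erase_mul _ _ (Finset.mem_univ k),
    ← Finset.prod_erase_mul _ (fun i => P i (s i)) (Finset.mem_univ k)]
  simp only [Function.update_self, measure_univ, mul_one]
  congr 1
  refine Finset.prod_congr rfl fun j hj => ?_
  rw [Function.update_of_ne (Finset.ne_of_mem_erase hj)]

variable [∀ j, TopologicalSpace (Ω j)] [∀ j, CompactSpace (Ω j)]
  [∀ j, SecondCountableTopology (Ω j)] [∀ j, OpensMeasurableSpace (Ω j)]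

lemma integral_eq_integral_update {E : Type*} [NormedAddCommGroup E] [NormedSpace ℝ E]
    {f : (∀ j, Ω j) → E} (hf : Continuous f) (k : J) :
    ∫ x, f x ∂(Measure.pi P) = ∫ x, ∫ y, f (Function.update x k y) ∂(P k) ∂(Measure.pi P) := by
  have h := measurePreserving_update P k
  have hi : Integrable f (Measure.pi P) := integrable_of_continuous hf
  conv_lhs => rw [← h.map_eq]
  rw [integral_map h.measurable.aemeasurable (h.map_eq.symm ▸ hi.aestronglyMeasurable)]
  exact integral_prod _ (h.integrable_comp_of_integrable hi)

/-- Integrate coordinate `k` first: `g` is then a constant factor and `h` averages to zero. -/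
lemma integral_mul_star_eq_zero {g h : (∀ j, Ω j) → ℂ} (hg : Continuous g) (hh : Continuous h)
    (k : J) (hgk : ∀ x y, g (Function.update x k y) = g x)
    (hhk : ∀ x, ∫ y, h (Function.update x k y) ∂(P k) = 0) :
    ∫ x, g x * star (h x) ∂(Measure.pi P) = 0 := by
  rw [integral_eq_integral_update P (f := fun x => g x * star (h x)) (hg.mul hh.star) k]
  simp only [hgk, integral_const_mul]
  refine integral_eq_zero_of_ae (Filter.Eventually.of_forall fun x => ?_)
  have : ∫ y, star (h (Function.update x k y)) ∂(P k) = 0 := by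
    have h1 := integral_conj (μ := P k) (f := fun y => h (Function.update x k y))
    rw [hhk x, map_zero] at h1
    exact h1
  simp only [this, mul_zero, Pi.zero_apply]

end Resample

/-! ### Second moments of sums, with and without orthogonality -/

section SecondMoment

/-- Expand the square: unrelated pairs vanish, and each of the at most `K` related partners of `i`
contributes at most `B` by the inequality between arithmetic and geometric means. `R` need not be
symmetric. -/
lemma integral_norm_sum_sq_le {X : Type*} [TopologicalSpace X] [CompactSpace X] [MeasurableSpace X]
    [OpensMeasurableSpace X] {μ : Measure X} [IsFiniteMeasure μ] {I : Type*} (s : Finset I)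
    {W : I → X → ℂ} (hW : ∀ i, Continuous (W i)) {B : ℝ} (hB : ∀ i ∈ s, ∫ x, ‖W i x‖ ^ 2 ∂μ ≤ B)
    (R : I → I → Prop) [DecidableRel R]
    (hR : ∀ i ∈ s, ∀ j ∈ s, ¬ R i j → ∫ x, W i x * star (W j x) ∂μ = 0)
    {K : ℕ} (hK : ∀ i ∈ s, (s.filter (R i)).card ≤ K) :
    ∫ x, ‖∑ i ∈ s, W i x‖ ^ 2 ∂μ ≤ s.card * (K * B) := by
  rcases s.eq_empty_or_nonempty with rfl | ⟨i₀, hi₀⟩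
  · simp
  have hB0 : 0 ≤ B := (integral_nonneg fun x => by positivity).trans (hB i₀ hi₀)
  have hexp : ∀ x, ‖∑ i ∈ s, W i x‖ ^ 2 = ∑ i ∈ s, ∑ j ∈ s, (W i x * star (W j x)).re := by
    intro x
    have : (‖∑ i ∈ s, W i x‖ ^ 2 : ℝ) = ((∑ i ∈ s, W i x) * star (∑ i ∈ s, W i x)).re := by
      rw [Complex.star_def, Complex.mul_conj, Complex.ofReal_re, Complex.normSq_eq_norm_sq]
    rw [this, star_sum, Finset.sum_mul_sum, Complex.re_sum]
    exact Finset.sum_congr rfl fun i _ => Complex.re_sum _ _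
  have hint : ∀ i j, Integrable (fun x => (W i x * star (W j x)).re) μ := fun i j =>
    integrable_of_continuous (Complex.continuous_re.comp ((hW i).mul (hW j).star))
  have hint2 : ∀ i, Integrable (fun x => ‖W i x‖ ^ 2) μ := fun i =>
    integrable_of_continuous ((hW i).norm.pow 2)
  simp only [hexp]
  rw [integral_finsetSum _ fun i _ => integrable_finsetSum _ fun j _ => hint i j]
  rw [← nsmul_eq_mul]
  refine Finset.sum_le_card_nsmul _ _ _ fun i hi => ?_
  rw [integral_finsetSum _ fun j _ => hint i j, ← Finset.sum_filter_add_sum_filter_not s (R i)]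
  have h0 : ∑ j ∈ s.filter (fun j => ¬ R i j), ∫ x, (W i x * star (W j x)).re ∂μ = 0 := by
    refine Finset.sum_eq_zero fun j hj => ?_
    rw [Finset.mem_filter] at hj
    have h1 := integral_re (μ := μ) (f := fun x => W i x * star (W j x))
      (integrable_of_continuous ((hW i).mul (hW j).star))
    rw [hR i hi j hj.1 hj.2] at h1
    simpa using h1
  rw [h0, add_zero]
  have h2 : ∀ j ∈ s.filter (R i), ∫ x, (W i x * star (W j x)).re ∂μ ≤ B := by
    intro j hj
    rw [Finset.mem_filter] at hj
    calc ∫ x, (W i x * star (W j x)).re ∂μ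
        ≤ ∫ x, (1 / 2 : ℝ) * (‖W i x‖ ^ 2 + ‖W j x‖ ^ 2) ∂μ := by
          refine integral_mono (hint i j) (((hint2 i).add (hint2 j)).const_mul _) fun x => ?_
          have h3 := Complex.re_le_norm (W i x * star (W j x))
          rw [norm_mul, norm_star] at h3
          simp only
          nlinarith [sq_nonneg (‖W i x‖ - ‖W j x‖)]
      _ = 1 / 2 * (∫ x, ‖W i x‖ ^ 2 ∂μ + ∫ x, ‖W j x‖ ^ 2 ∂μ) := by
          rw [integral_const_mul, integral_add (hint2 i) (hint2 j)]
      _ ≤ B := by linarith [hB i hi, hB j hj.1]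
  refine (Finset.sum_le_card_nsmul _ _ _ h2).trans ?_
  rw [nsmul_eq_mul]
  have := hK i hi
  gcongr

lemma integral_norm_sum_sq_le_card {X : Type*} [TopologicalSpace X] [CompactSpace X]
    [MeasurableSpace X] [OpensMeasurableSpace X] {μ : Measure X} [IsFiniteMeasure μ] {I : Type*}
    (s : Finset I) {Y : I → X → ℂ} (hY : ∀ i, Continuous (Y i)) {V : ℝ}
    (hV : ∀ i ∈ s, ∫ x, ‖Y i x‖ ^ 2 ∂μ ≤ V) :
    ∫ x, ‖∑ i ∈ s, Y i x‖ ^ 2 ∂μ ≤ s.card * (s.card * V) := by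
  have hint : ∀ i, Integrable (fun x => ‖Y i x‖ ^ 2) μ := fun i =>
    integrable_of_continuous ((hY i).norm.pow 2)
  calc ∫ x, ‖∑ i ∈ s, Y i x‖ ^ 2 ∂μ ≤ ∫ x, (s.card : ℝ) * ∑ i ∈ s, ‖Y i x‖ ^ 2 ∂μ := by
        refine integral_mono
          (integrable_of_continuous ((continuous_finsetSum _ fun a _ => hY a).norm.pow 2))
          ((integrable_finsetSum _ fun a _ => hint a).const_mul _) fun x => ?_
        calc ‖∑ a ∈ s, Y a x‖ ^ 2 ≤ (∑ a ∈ s, ‖Y a x‖) ^ 2 := by gcongr; exact norm_sum_le _ _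
          _ ≤ _ := sq_sum_le_card_mul_sum_sq
    _ = s.card * ∑ i ∈ s, ∫ x, ‖Y i x‖ ^ 2 ∂μ := by
        rw [integral_const_mul, integral_finsetSum _ fun a _ => hint a]
    _ ≤ _ := by
        refine mul_le_mul_of_nonneg_left ?_ (Nat.cast_nonneg _)
        rw [← nsmul_eq_mul]
        exact Finset.sum_le_card_nsmul _ _ _ hV

end SecondMoment

/-! ### Noise expansion and variance of U-statistics of trace products -/

section Noise

variable {m : Type*} [Fintype m] [DecidableEq m]

/-- A centred random matrix `Z` whose linear functionals `Tr(Z A)` have second moment at most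
`v ‖A‖²` and whose products `Z A` have second moment at most `w ‖A‖²`, in Hilbert–Schmidt norm. -/
structure IsNoise {Ω : Type*} [MeasurableSpace Ω] [TopologicalSpace Ω] (P : Measure Ω)
    (Z : Ω → Matrix m m ℂ) (v w : ℝ) : Prop where
  continuous : Continuous Z
  integral_trace : ∀ A, ∫ y, (Z y * A).trace ∂P = 0
  integral_trace_sq_le : ∀ A, ∫ y, ‖(Z y * A).trace‖ ^ 2 ∂P ≤ v * frobSq A
  integral_mul_le : ∀ A : Matrix m m ℂ, ∫ y, frobSq (Z y * A) ∂P ≤ w * frobSq A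

lemma continuous_frobSq {m : Type*} [Fintype m] : Continuous (frobSq : Matrix m m ℂ → ℝ) := by
  unfold frobSq
  exact continuous_finsetSum _ fun i _ => continuous_finsetSum _ fun j _ =>
    (continuous_id.matrix_elem i j).norm.pow 2

/-- The trace pairing represents every functional, so centredness, stated for `Tr(Z A)`, applies to
noise in any slot of a product. -/
lemma exists_eq_trace_mul (φ : Matrix m m ℂ →ₗ[ℂ] ℂ) : ∃ A, ∀ Z, φ Z = (Z * A).trace := by
  refine ⟨Matrix.of fun y x => φ (Matrix.single x y 1), fun Z => ?_⟩
  conv_lhs => rw [Matrix.matrix_eq_sum_single Z]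
  simp only [map_sum, Matrix.trace, Matrix.diag_apply, Matrix.mul_apply, Matrix.of_apply]
  refine Finset.sum_congr rfl fun x _ => Finset.sum_congr rfl fun y _ => ?_
  have : Matrix.single x y (Z x y) = Z x y • Matrix.single x y (1 : ℂ) := by simp
  rw [this, map_smul, smul_eq_mul]

/-- The trace of a product of `r` matrices, as a multilinear map. -/
def traceProd (m : Type*) [Fintype m] [DecidableEq m] (r : ℕ) :
    MultilinearMap ℂ (fun _ : Fin r => Matrix m m ℂ) ℂ :=
  (Matrix.traceLinearMap m ℂ ℂ).compMultilinearMap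
    (MultilinearMap.mkPiAlgebraFin ℂ r (Matrix m m ℂ))

lemma traceProd_apply (r : ℕ) (v : Fin r → Matrix m m ℂ) :
    traceProd m r v = (List.ofFn v).prod.trace := rfl

lemma continuous_traceProd (r : ℕ) : Continuous (traceProd m r) :=
  (ContinuousMultilinearMap.mkPiAlgebraFin ℂ r (Matrix m m ℂ)).cont.matrix_trace

variable {J : Type*} {Ω : J → Type*} {Z : ∀ j, Ω j → Matrix m m ℂ}

/-- The component of `Tr ∏ₛ (Z_{T s} + C s)` in which exactly the slots in `a` carry noise. -/
def noiseTerm (Z : ∀ j, Ω j → Matrix m m ℂ) {r : ℕ} (C : Fin r → Matrix m m ℂ) (a : Finset (Fin r))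
    (T : Fin r → J) (x : ∀ j, Ω j) : ℂ :=
  traceProd m r (a.piecewise (fun s => Z (T s) (x (T s))) C)

variable {r : ℕ} {C : Fin r → Matrix m m ℂ}

lemma traceProd_add (T : Fin r → J) (x : ∀ j, Ω j) :
    traceProd m r (fun s => Z (T s) (x (T s)) + C s) = ∑ a, noiseTerm Z C a T x :=
  (traceProd m r).map_add_univ (fun s => Z (T s) (x (T s))) C

variable {I : Type*} {F : Finset I} {τ : I → Fin r → J}

/-- The noiseless component is the same for every tuple, so subtracting the target removes exactly
`a = ∅`. -/
lemma mean_traceProd_sub (hF : F.Nonempty) (x : ∀ j, Ω j) :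
    (F.card : ℂ)⁻¹ * ∑ i ∈ F, traceProd m r (fun s => Z (τ i s) (x (τ i s)) + C s) -
      traceProd m r C =
    ∑ a ∈ Finset.univ.erase ∅, (F.card : ℂ)⁻¹ * ∑ i ∈ F, noiseTerm Z C a (τ i) x := by
  have hF0 : (F.card : ℂ) ≠ 0 := by exact_mod_cast hF.card_pos.ne'
  have h0 : (F.card : ℂ)⁻¹ * ∑ i ∈ F, noiseTerm Z C ∅ (τ i) x = traceProd m r C := by
    simp only [noiseTerm, Finset.piecewise_empty, Finset.sum_const, nsmul_eq_mul]
    rw [inv_mul_cancel_left₀ hF0]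
  rw [← h0, sub_eq_iff_eq_add, Finset.sum_erase_add _ _ (Finset.mem_univ _), ← Finset.mul_sum,
    Finset.sum_comm]
  simp only [traceProd_add]

lemma continuous_noiseTerm [∀ j, TopologicalSpace (Ω j)] (hZ : ∀ j, Continuous (Z j))
    (a : Finset (Fin r)) (T : Fin r → J) :
    Continuous (noiseTerm Z C a T) := by
  refine (continuous_traceProd r).comp (continuous_pi fun s => ?_)
  by_cases hs : s ∈ a
  · simp only [Finset.piecewise_eq_of_mem _ _ _ hs]
    exact (hZ _).comp (continuous_apply _)
  · simp only [Finset.piecewise_eq_of_notMem _ _ _ hs]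
    exact continuous_const

variable [DecidableEq J]

lemma noiseTerm_update_of_forall_ne (a : Finset (Fin r)) (T : Fin r → J) {k : J}
    (hk : ∀ s, T s ≠ k) (x : ∀ j, Ω j) (y : Ω k) :
    noiseTerm Z C a T (Function.update x k y) = noiseTerm Z C a T x := by
  simp only [noiseTerm, Function.update_of_ne (hk _)]

/-- Injectivity of `T` confines the run `T s` to slot `s`, so the term is linear in its noise, which
is centred. -/
lemma integral_noiseTerm_update [∀ j, MeasurableSpace (Ω j)] {P : ∀ j, Measure (Ω j)}
    (hZ : ∀ j A, ∫ y, (Z j y * A).trace ∂(P j) = 0)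
    (a : Finset (Fin r)) {T : Fin r → J} (hT : Function.Injective T) {s : Fin r} (hs : s ∈ a)
    (x : ∀ j, Ω j) :
    ∫ y, noiseTerm Z C a T (Function.update x (T s) y) ∂(P (T s)) = 0 := by
  set u := a.piecewise (fun s => Z (T s) (x (T s))) C with hu
  have h : ∀ y, noiseTerm Z C a T (Function.update x (T s) y) =
      (traceProd m r).toLinearMap u s (Z (T s) y) := by
    intro y
    rw [MultilinearMap.toLinearMap_apply, noiseTerm]
    congr 1
    funext s'
    by_cases hs' : s' = s
    · subst hs'
      simp [Finset.piecewise_eq_of_mem _ _ _ hs]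
    · rw [Function.update_of_ne hs', hu]
      by_cases ha : s' ∈ a
      · rw [Finset.piecewise_eq_of_mem _ _ _ ha, Finset.piecewise_eq_of_mem _ _ _ ha,
          Function.update_of_ne (hT.ne hs')]
      · rw [Finset.piecewise_eq_of_notMem _ _ _ ha, Finset.piecewise_eq_of_notMem _ _ _ ha]
  obtain ⟨A, hA⟩ := exists_eq_trace_mul ((traceProd m r).toLinearMap u s)
  simp only [h, hA, hZ]

variable [Fintype J] [∀ j, MeasurableSpace (Ω j)]
  {P : ∀ j, Measure (Ω j)} [∀ j, IsProbabilityMeasure (P j)]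
  [∀ j, TopologicalSpace (Ω j)] [∀ j, CompactSpace (Ω j)]
  [∀ j, SecondCountableTopology (Ω j)] [∀ j, OpensMeasurableSpace (Ω j)]

/-- Conditionally on the other runs `R` is a fixed matrix, so the single-run bound applies and is
then averaged. -/
lemma IsNoise.pi_trace_sq_le {m : Type*} [Fintype m] {Z : ∀ j, Ω j → Matrix m m ℂ}
    {k : J} {v w : ℝ} (h : IsNoise (P k) (Z k) v w)
    {R : (∀ j, Ω j) → Matrix m m ℂ} (hR : Continuous R)
    (hRk : ∀ x y, R (Function.update x k y) = R x) :
    ∫ x, ‖(Z k (x k) * R x).trace‖ ^ 2 ∂(Measure.pi P) ≤ v * ∫ x, frobSq (R x) ∂(Measure.pi P) := by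
  have hc : Continuous fun x : ∀ j, Ω j => ‖(Z k (x k) * R x).trace‖ ^ 2 :=
    (((h.continuous.comp (continuous_apply k)).matrix_mul hR).matrix_trace).norm.pow 2
  rw [integral_eq_integral_update P hc k, ← integral_const_mul]
  simp only [hRk, Function.update_self]
  refine integral_mono_of_nonneg (Filter.Eventually.of_forall fun x =>
    integral_nonneg fun y => by positivity)
    ((integrable_of_continuous (continuous_frobSq.comp hR)).const_mul v)
    (Filter.Eventually.of_forall fun x => h.integral_trace_sq_le (R x))

lemma IsNoise.pi_mul_le {m : Type*} [Fintype m] {Z : ∀ j, Ω j → Matrix m m ℂ}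
    {k : J} {v w : ℝ} (h : IsNoise (P k) (Z k) v w)
    {R : (∀ j, Ω j) → Matrix m m ℂ} (hR : Continuous R)
    (hRk : ∀ x y, R (Function.update x k y) = R x) :
    ∫ x, frobSq (Z k (x k) * R x) ∂(Measure.pi P) ≤ w * ∫ x, frobSq (R x) ∂(Measure.pi P) := by
  have hc : Continuous fun x : ∀ j, Ω j => frobSq (Z k (x k) * R x) :=
    continuous_frobSq.comp ((h.continuous.comp (continuous_apply k)).matrix_mul hR)
  rw [integral_eq_integral_update P hc k, ← integral_const_mul]
  simp only [hRk, Function.update_self]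
  refine integral_mono_of_nonneg (Filter.Eventually.of_forall fun x =>
    integral_nonneg fun y => frobSq_nonneg _)
    ((integrable_of_continuous (continuous_frobSq.comp hR)).const_mul w)
    (Filter.Eventually.of_forall fun x => h.integral_mul_le (R x))

lemma integral_noiseTerm (hc : ∀ j, Continuous (Z j))
    (hZ : ∀ j A, ∫ y, (Z j y * A).trace ∂(P j) = 0)
    {a : Finset (Fin r)} (ha : a.Nonempty) {T : Fin r → J} (hT : Function.Injective T) :
    ∫ x, noiseTerm Z C a T x ∂(Measure.pi P) = 0 := by
  obtain ⟨s, hs⟩ := ha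
  rw [integral_eq_integral_update P (continuous_noiseTerm hc a T) (T s)]
  simp [integral_noiseTerm_update hZ a hT hs]

/-- A pair of tuples can correlate only if every noisy run of the second occurs in the first. Given
the first tuple, this leaves at most `r` choices for a noisy slot and all of `N s` for the others.
-/
lemma integral_norm_sum_noiseTerm_sq_le (hc : ∀ j, Continuous (Z j))
    (hZ : ∀ j A, ∫ y, (Z j y * A).trace ∂(P j) = 0)
    (hτ : ∀ i ∈ F, Function.Injective (τ i)) (hinj : Set.InjOn τ F)
    {N : Fin r → Finset J} (hN : ∀ i ∈ F, ∀ s, τ i s ∈ N s) (a : Finset (Fin r))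
    {B : ℝ} (hB : ∀ i ∈ F, ∫ x, ‖noiseTerm Z C a (τ i) x‖ ^ 2 ∂(Measure.pi P) ≤ B) :
    ∫ x, ‖∑ i ∈ F, noiseTerm Z C a (τ i) x‖ ^ 2 ∂(Measure.pi P) ≤
      F.card * ((∏ s, if s ∈ a then r else (N s).card : ℕ) * B) := by
  classical
  refine integral_norm_sum_sq_le F (fun i => continuous_noiseTerm hc a (τ i)) hB
    (fun i j => ∀ s ∈ a, τ j s ∈ Finset.univ.image (τ i)) ?_ ?_
  · intro i hi j hj hij
    push Not at hij
    obtain ⟨s, hs, hsi⟩ := hij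
    refine integral_mul_star_eq_zero P (continuous_noiseTerm hc a _) (continuous_noiseTerm hc a _)
      (τ j s) (fun x y => noiseTerm_update_of_forall_ne a (τ i) (fun s' h => hsi ?_) x y)
      (integral_noiseTerm_update hZ a (hτ j hj) hs)
    exact Finset.mem_image.2 ⟨s', Finset.mem_univ _, h⟩
  · intro i hi
    -- As `τ` is injective on `F`, the correlated partners can be counted through their index
    -- tuples, which lie in a box.
    have hsub : (F.filter fun j => ∀ s ∈ a, τ j s ∈ Finset.univ.image (τ i)).image τ ⊆
        Fintype.piFinset fun s => if s ∈ a then Finset.univ.image (τ i) else N s := by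
      intro t ht
      obtain ⟨j, hj, rfl⟩ := Finset.mem_image.1 ht
      rw [Finset.mem_filter] at hj
      rw [Fintype.mem_piFinset]
      intro s
      split_ifs with hs
      · exact hj.2 s hs
      · exact hN j hj.1 s
    rw [← Finset.card_image_of_injOn (hinj.mono (Finset.coe_subset.2 (Finset.filter_subset _ _)))]
    refine (Finset.card_le_card hsub).trans ?_
    rw [Fintype.card_piFinset]
    refine Finset.prod_le_prod' fun s _ => ?_
    split_ifs
    · exact Finset.card_image_le.trans (by simp)
    · exact le_rfl


lemma integral_mean_traceProd (hc : ∀ j, Continuous (Z j))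
    (hZ : ∀ j A, ∫ y, (Z j y * A).trace ∂(P j) = 0)
    (hF : F.Nonempty) (hτ : ∀ i ∈ F, Function.Injective (τ i)) :
    ∫ x, (F.card : ℂ)⁻¹ * ∑ i ∈ F, traceProd m r (fun s => Z (τ i s) (x (τ i s)) + C s)
      ∂(Measure.pi P) = traceProd m r C := by
  have hF0 : (F.card : ℂ) ≠ 0 := by exact_mod_cast hF.card_pos.ne'
  have hint : ∀ a i, Integrable (noiseTerm Z C a (τ i)) (Measure.pi P) := fun a i =>
    integrable_of_continuous (continuous_noiseTerm hc a (τ i))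
  have h : ∀ i ∈ F, ∫ x, ∑ a, noiseTerm Z C a (τ i) x ∂(Measure.pi P) = traceProd m r C := by
    intro i hi
    rw [integral_finsetSum _ fun a _ => hint a i, Finset.sum_eq_single ∅]
    · simp [noiseTerm]
    · intro a _ ha
      exact integral_noiseTerm hc hZ (Finset.nonempty_iff_ne_empty.2 ha) (hτ i hi)
    · simp
  simp only [traceProd_add]
  rw [integral_const_mul, integral_finsetSum _ fun i _ => integrable_finsetSum _ fun a _ =>
    hint a i,
    Finset.sum_congr rfl h, Finset.sum_const, nsmul_eq_mul, inv_mul_cancel_left₀ hF0]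

/-- Each noisy slot trades `N s ≥ cD` choices for `r`, which pays for a factor `cD`. All the factors
`D` are used, but only one of the factors `c` is kept. -/
lemma prod_ite_mul_pow_le {r : ℕ} (hr : 1 ≤ r) (a : Finset (Fin r)) (ha : a.Nonempty)
    (N : Fin r → ℕ) {c D : ℝ} (hD : 0 < D) (hc : 1 ≤ c) (hcD : ∀ s, c * D ≤ N s) :
    ((∏ s, if s ∈ a then r else N s : ℕ) : ℝ) * D ^ a.card * c ≤ r ^ r * ∏ s, (N s : ℝ) := by
  have hr' : (1 : ℝ) ≤ r := by exact_mod_cast hr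
  have hc0 : 0 < c := by linarith
  have e1 : (c * D) ^ a.card = ∏ s : Fin r, if s ∈ a then c * D else 1 := by
    rw [Finset.prod_ite_mem, Finset.univ_inter, Finset.prod_const]
  have e2 : (r : ℝ) ^ r = ∏ _s : Fin r, (r : ℝ) := by simp
  calc ((∏ s, if s ∈ a then r else N s : ℕ) : ℝ) * D ^ a.card * c
      ≤ ((∏ s, if s ∈ a then r else N s : ℕ) : ℝ) * D ^ a.card * c ^ a.card := by
        gcongr
        exact le_self_pow₀ hc ha.card_pos.ne'
    _ = ((∏ s, if s ∈ a then r else N s : ℕ) : ℝ) * (c * D) ^ a.card := by rw [mul_pow]; ring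
    _ ≤ r ^ r * ∏ s, (N s : ℝ) := by
        rw [e1, e2, Nat.cast_prod, ← Finset.prod_mul_distrib, ← Finset.prod_mul_distrib]
        refine Finset.prod_le_prod (fun s _ => by positivity) fun s _ => ?_
        split_ifs
        · exact mul_le_mul_of_nonneg_left (hcD s) (by positivity)
        · rw [mul_one]
          exact le_mul_of_one_le_left (Nat.cast_nonneg _) hr'

/-- The saving `(cD)^(-|a|)` in correlated pairs cancels the growth `D^|a|` of a single term. The
constant `q` compares the box of all index tuples with the family `F` actually averaged. -/
lemma integral_norm_mean_noiseTerm_sq_le (hc : ∀ j, Continuous (Z j))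
    (hZ : ∀ j A, ∫ y, (Z j y * A).trace ∂(P j) = 0)
    (hF : F.Nonempty) (hτ : ∀ i ∈ F, Function.Injective (τ i)) (hinj : Set.InjOn τ F)
    {N : Fin r → Finset J} (hN : ∀ i ∈ F, ∀ s, τ i s ∈ N s) {B D c q : ℝ} (hB0 : 0 ≤ B)
    (hD : 0 < D) (hc1 : 1 ≤ c) (hr : 1 ≤ r) {a : Finset (Fin r)} (ha : a.Nonempty)
    (hB : ∀ i ∈ F, ∫ x, ‖noiseTerm Z C a (τ i) x‖ ^ 2 ∂(Measure.pi P) ≤ B * D ^ a.card)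
    (hq : (∏ s, ((N s).card : ℝ)) ≤ q * F.card) (hcD : ∀ s, c * D ≤ (N s).card) :
    ∫ x, ‖(F.card : ℂ)⁻¹ * ∑ i ∈ F, noiseTerm Z C a (τ i) x‖ ^ 2 ∂(Measure.pi P) ≤
      r ^ r * q * B / c := by
  have hF0 : (0 : ℝ) < F.card := by exact_mod_cast hF.card_pos
  have hc0 : 0 < c := by linarith
  have h1 := integral_norm_sum_noiseTerm_sq_le (P := P) (C := C) hc hZ hτ hinj hN a hB
  have hK := prod_ite_mul_pow_le hr a ha (fun s => (N s).card) hD hc1 hcD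
  simp only [norm_mul, mul_pow, norm_inv, Complex.norm_natCast]
  rw [integral_const_mul, le_div_iff₀ hc0]
  generalize (∫ x, ‖∑ i ∈ F, noiseTerm Z C a (τ i) x‖ ^ 2 ∂(Measure.pi P)) = I at h1 ⊢
  generalize ((∏ s, if s ∈ a then r else (N s).card : ℕ) : ℝ) = K at h1 hK
  generalize (∏ s, ((N s).card : ℝ)) = Q at hq hK
  generalize (F.card : ℝ) = f at *
  have hK2 : K * D ^ a.card * c ≤ r ^ r * (q * f) :=
    hK.trans (mul_le_mul_of_nonneg_left hq (by positivity))
  calc (f⁻¹) ^ 2 * I * c ≤ (f⁻¹) ^ 2 * (f * (K * (B * D ^ a.card))) * c := by gcongr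
    _ = f⁻¹ * B * (K * D ^ a.card * c) := by field_simp
    _ ≤ f⁻¹ * B * (r ^ r * (q * f)) := by gcongr
    _ = r ^ r * q * B := by field_simp

/-- Variance bound for a U-statistic built from traces of products of independent matrices. -/
theorem integral_norm_mean_traceProd_sub_sq_le (hc : ∀ j, Continuous (Z j))
    (hZ : ∀ j A, ∫ y, (Z j y * A).trace ∂(P j) = 0)
    (hF : F.Nonempty) (hτ : ∀ i ∈ F, Function.Injective (τ i)) (hinj : Set.InjOn τ F)
    {N : Fin r → Finset J} (hN : ∀ i ∈ F, ∀ s, τ i s ∈ N s) {B D c q : ℝ} (hB0 : 0 ≤ B)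
    (hD : 0 < D) (hc1 : 1 ≤ c) (hr : 1 ≤ r)
    (hB : ∀ a : Finset (Fin r), a.Nonempty → ∀ i ∈ F,
      ∫ x, ‖noiseTerm Z C a (τ i) x‖ ^ 2 ∂(Measure.pi P) ≤ B * D ^ a.card)
    (hq : (∏ s, ((N s).card : ℝ)) ≤ q * F.card) (hcD : ∀ s, c * D ≤ (N s).card) :
    ∫ x, ‖(F.card : ℂ)⁻¹ * ∑ i ∈ F, traceProd m r (fun s => Z (τ i s) (x (τ i s)) + C s) -
      traceProd m r C‖ ^ 2 ∂(Measure.pi P) ≤ 4 ^ r * (r ^ r * q * B / c) := by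
  have hF0 : (0 : ℝ) < F.card := by exact_mod_cast hF.card_pos
  have hdecomp := fun x => mean_traceProd_sub (Z := Z) (C := C) (τ := τ) hF x
  simp only [hdecomp]
  have hq0 : 0 ≤ q := by
    by_contra hq0
    have : (0 : ℝ) ≤ ∏ s, ((N s).card : ℝ) := by positivity
    nlinarith
  -- Cauchy–Schwarz over the noise components costs their number, and summing their bounds costs it
  -- once more; hence `4 ^ r`.
  have hAc : (((Finset.univ : Finset (Finset (Fin r))).erase ∅).card : ℝ) ≤ 2 ^ r := by
    have : ((Finset.univ : Finset (Finset (Fin r))).erase ∅).card ≤ 2 ^ r :=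
      (Finset.card_le_univ _).trans_eq (by simp)
    exact_mod_cast this
  have hV0 : 0 ≤ r ^ r * q * B / c := by positivity
  refine (integral_norm_sum_sq_le_card (V := r ^ r * q * B / c) _ (fun a => continuous_const.mul
    (continuous_finsetSum _ fun i _ => continuous_noiseTerm hc a (τ i))) fun a ha => ?_).trans ?_
  · have hane : a.Nonempty := Finset.nonempty_iff_ne_empty.2 (Finset.ne_of_mem_erase ha)
    exact integral_norm_mean_noiseTerm_sq_le hc hZ hF hτ hinj hN hB0 hD hc1 hr hane (hB a hane)
      hq hcD
  · generalize r ^ r * q * B / c = V at hV0 ⊢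
    have hA0 : (0 : ℝ) ≤ ((Finset.univ : Finset (Finset (Fin r))).erase ∅).card := Nat.cast_nonneg _
    generalize (((Finset.univ : Finset (Finset (Fin r))).erase ∅).card : ℝ) = A at hAc hA0 ⊢
    calc A * (A * V) ≤ 2 ^ r * (2 ^ r * V) := by gcongr
      _ = 4 ^ r * V := by rw [← mul_assoc, ← mul_pow]; norm_num

end Noise

/-! ### Centred shadows as noise -/

section ShadowNoise

lemma integral_norm_sub_sq_le {X : Type*} [TopologicalSpace X] [CompactSpace X] [MeasurableSpace X]
    [OpensMeasurableSpace X] {μ : Measure X} [IsProbabilityMeasure μ] {f : X → ℂ}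
    (hf : Continuous f) {c : ℂ} (hc : ∫ x, f x ∂μ = c) :
    ∫ x, ‖f x - c‖ ^ 2 ∂μ ≤ ∫ x, ‖f x‖ ^ 2 ∂μ := by
  have h1 : ∀ x, ‖f x - c‖ ^ 2 = ‖f x‖ ^ 2 - 2 * (f x * star c).re + ‖c‖ ^ 2 := fun x => by
    rw [← Complex.normSq_eq_norm_sq, ← Complex.normSq_eq_norm_sq, ← Complex.normSq_eq_norm_sq,
      Complex.normSq_sub]
    simp only [Complex.star_def]
    ring
  have hi1 : Integrable (fun x => ‖f x‖ ^ 2) μ := integrable_of_continuous (hf.norm.pow 2)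
  have hi2 : Integrable (fun x => f x * star c) μ :=
    integrable_of_continuous (hf.mul continuous_const)
  have hi3 : Integrable (fun x => 2 * (f x * star c).re) μ := hi2.re.const_mul 2
  have hi4 : Integrable (fun x => ‖f x‖ ^ 2 - 2 * (f x * star c).re) μ := hi1.sub hi3
  have h2 : ∫ x, (f x * star c).re ∂μ = ‖c‖ ^ 2 := by
    have h3 := integral_re (μ := μ) hi2
    rw [integral_mul_const, hc] at h3
    rw [Complex.star_def, Complex.mul_conj, Complex.normSq_eq_norm_sq] at h3
    exact h3
  simp only [h1]
  rw [integral_add hi4 (integrable_const _), integral_sub hi1 hi3, integral_const_mul, h2]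
  simp only [integral_const, probReal_univ, one_smul]
  nlinarith [sq_nonneg ‖c‖]

variable {n : Type*} [Fintype n] [DecidableEq n]

lemma IsNoise.mono {Ω : Type*} [MeasurableSpace Ω] [TopologicalSpace Ω] {P : Measure Ω}
    {n : Type*} [Fintype n] {Z : Ω → Matrix n n ℂ} {v w v' w' : ℝ} (h : IsNoise P Z v w)
    (hv : v ≤ v') (hw : w ≤ w') :
    IsNoise P Z v' w' :=
  ⟨h.continuous, h.integral_trace,
    fun A => (h.integral_trace_sq_le A).trans (mul_le_mul_of_nonneg_right hv (frobSq_nonneg A)),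
    fun A => (h.integral_mul_le A).trans (mul_le_mul_of_nonneg_right hw (frobSq_nonneg A))⟩

lemma trace_mul_vecMulVec_single (Y : Matrix n n ℂ) (u : n → ℂ) (i : n) :
    (Y * Matrix.vecMulVec u (Pi.single i 1)).trace = ∑ k, Y i k * u k := by
  rw [Matrix.mul_vecMulVec, Matrix.trace_vecMulVec]
  rw [dotProduct_single, mul_one]
  rfl

lemma frobSq_vecMulVec_single (u : n → ℂ) (i : n) :
    frobSq (Matrix.vecMulVec u (Pi.single i 1)) = ∑ k, ‖u k‖ ^ 2 := by
  unfold frobSq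
  refine Finset.sum_congr rfl fun k _ => ?_
  rw [Finset.sum_eq_single i]
  · simp [Matrix.vecMulVec_apply]
  · intro j _ hj
    simp [Matrix.vecMulVec_apply, hj]
  · simp

lemma integrable_norm_mul_sq {Ω : Type*} [TopologicalSpace Ω] [CompactSpace Ω]
    [MeasurableSpace Ω] [OpensMeasurableSpace Ω] {P : Measure Ω} [IsFiniteMeasure P]
    {n : Type*} [Fintype n] {Z : Ω → Matrix n n ℂ} (hZ : Continuous Z) (i : n) (u : n → ℂ) :
    Integrable (fun y => ‖∑ k, Z y i k * u k‖ ^ 2) P :=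
  integrable_of_continuous ((continuous_finsetSum _ fun k _ =>
    (hZ.matrix_elem i k).mul continuous_const).norm.pow 2)

/-- Each coordinate of `Z u` is `Tr(Z A)` for the rank-one matrix `A = u eᵢᵀ`, with `‖A‖ = ‖u‖`.
Summing over the coordinates costs the dimension. -/
lemma integral_sum_norm_mul_sq_le {Ω : Type*} [TopologicalSpace Ω] [CompactSpace Ω]
    [MeasurableSpace Ω] [OpensMeasurableSpace Ω] {P : Measure Ω} [IsFiniteMeasure P]
    {Z : Ω → Matrix n n ℂ} (hZ : Continuous Z) {v : ℝ}
    (h : ∀ A, ∫ y, ‖(Z y * A).trace‖ ^ 2 ∂P ≤ v * frobSq A) (u : n → ℂ) :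
    ∫ y, ∑ i, ‖∑ k, Z y i k * u k‖ ^ 2 ∂P ≤ v * Fintype.card n * ∑ k, ‖u k‖ ^ 2 := by
  rw [integral_finsetSum _ fun i _ => integrable_norm_mul_sq hZ i u]
  calc ∑ i, ∫ y, ‖∑ k, Z y i k * u k‖ ^ 2 ∂P ≤ ∑ _i : n, v * ∑ k, ‖u k‖ ^ 2 := by
        refine Finset.sum_le_sum fun i _ => ?_
        have := h (Matrix.vecMulVec u (Pi.single i 1))
        simpa only [trace_mul_vecMulVec_single, frobSq_vecMulVec_single] using this
    _ = _ := by
        rw [Finset.sum_const, Finset.card_univ, nsmul_eq_mul]; ring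

lemma integral_frobSq_mul_le {Ω : Type*} [TopologicalSpace Ω] [CompactSpace Ω]
    [MeasurableSpace Ω] [OpensMeasurableSpace Ω] {P : Measure Ω} [IsFiniteMeasure P]
    {Z : Ω → Matrix n n ℂ} (hZ : Continuous Z) {v : ℝ}
    (h : ∀ A, ∫ y, ‖(Z y * A).trace‖ ^ 2 ∂P ≤ v * frobSq A) (A : Matrix n n ℂ) :
    ∫ y, frobSq (Z y * A) ∂P ≤ v * Fintype.card n * frobSq A := by
  have h1 : ∀ y, frobSq (Z y * A) = ∑ j, ∑ i, ‖∑ k, Z y i k * A k j‖ ^ 2 := fun y => by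
    rw [Finset.sum_comm]
    rfl
  simp only [h1]
  rw [integral_finsetSum _ fun j _ => integrable_finsetSum _ fun i _ =>
    integrable_norm_mul_sq hZ i fun k => A k j, frobSq, Finset.sum_comm, Finset.mul_sum]
  exact Finset.sum_le_sum fun j _ => integral_sum_norm_mul_sq_le hZ h fun k => A k j

variable [TopologicalSpace n] [DiscreteTopology n]

lemma continuous_shadow_sub (ρ : Matrix n n ℂ) :
    Continuous fun x : Matrix.unitaryGroup n ℂ × n => shadow x - ρ :=
  continuous_shadow.sub (continuous_const (y := ρ))

variable [MeasurableSpace n] [OpensMeasurableSpace n]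
  {ν : Measure (Matrix.unitaryGroup n ℂ)} [IsProbabilityMeasure ν] {ρ : Matrix n n ℂ}

lemma integral_trace_shadow_sub (hρ : IsState ρ) (hν : IsUnitaryDesign 3 ν) (A : Matrix n n ℂ) :
    ∫ x, ((shadow x - ρ) * A).trace ∂(runLaw ν ρ) = 0 := by
  have := isProbabilityMeasure_runLaw (ν := ν) hρ
  simp only [sub_mul, Matrix.trace_sub]
  rw [integral_sub (integrable_of_continuous
    (continuous_shadow.matrix_mul continuous_const).matrix_trace) (integrable_const _),
    integral_trace_shadow_mul hρ hν]
  simp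

lemma integral_norm_trace_shadow_sub_sq_le (hρ : IsState ρ) (hν : IsUnitaryDesign 3 ν)
    (A : Matrix n n ℂ) :
    ∫ x, ‖((shadow x - ρ) * A).trace‖ ^ 2 ∂(runLaw ν ρ) ≤ 4 * frobSq A := by
  have := isProbabilityMeasure_runLaw (ν := ν) hρ
  simp only [sub_mul, Matrix.trace_sub]
  exact (integral_norm_sub_sq_le (continuous_shadow.matrix_mul continuous_const).matrix_trace
    (integral_trace_shadow_mul hρ hν A)).trans (integral_norm_trace_shadow_mul_sq_le hρ hν A)

theorem isNoise_shadow (hρ : IsState ρ) (hν : IsUnitaryDesign 3 ν) :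
    IsNoise (runLaw ν ρ) (fun x => shadow x - ρ) 4 (4 * Fintype.card n) := by
  have := isProbabilityMeasure_runLaw (ν := ν) hρ
  exact ⟨continuous_shadow_sub ρ, integral_trace_shadow_sub hρ hν,
    integral_norm_trace_shadow_sub_sq_le hρ hν,
    integral_frobSq_mul_le (continuous_shadow_sub ρ) (integral_norm_trace_shadow_sub_sq_le hρ hν)⟩

end ShadowNoise

/-! ### Partial trace and noise acting on one tensor factor -/

section PartialTrace

variable {a b : Type*} [Fintype a] [Fintype b]

lemma frobSq_traceB_le (B : Matrix (a × b) (a × b) ℂ) :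
    frobSq (traceB B) ≤ Fintype.card b * frobSq B := by
  have h : ∀ i j, ‖traceB B i j‖ ^ 2 ≤ Fintype.card b * ∑ k, ‖B (i, k) (j, k)‖ ^ 2 := by
    intro i j
    calc ‖traceB B i j‖ ^ 2 ≤ (∑ k, ‖B (i, k) (j, k)‖) ^ 2 := by
          gcongr; exact norm_sum_le _ _
      _ ≤ _ := by simpa using sq_sum_le_card_mul_sum_sq (s := (Finset.univ : Finset b))
                    (f := fun k => ‖B (i, k) (j, k)‖)
  calc frobSq (traceB B) ≤ ∑ i, ∑ j, Fintype.card b * ∑ k, ‖B (i, k) (j, k)‖ ^ 2 :=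
        Finset.sum_le_sum fun i _ => Finset.sum_le_sum fun j _ => h i j
    _ = Fintype.card b * ∑ i, ∑ k, ∑ j, ‖B (i, k) (j, k)‖ ^ 2 := by
        simp only [Finset.mul_sum]
        exact Finset.sum_congr rfl fun i _ => Finset.sum_comm
    _ ≤ Fintype.card b * frobSq B := by
        unfold frobSq
        simp only [Fintype.sum_prod_type]
        gcongr with i _ k _ j _
        exact Finset.single_le_sum (f := fun l => ‖B (i, k) (j, l)‖ ^ 2)
          (fun _ _ => by positivity) (Finset.mem_univ k)

lemma trace_traceB (X : Matrix (a × b) (a × b) ℂ) : (traceB X).trace = X.trace := by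
  simp [traceB, Matrix.trace, Fintype.sum_prod_type]

lemma isState_traceB {ρ : Matrix (a × b) (a × b) ℂ} (hρ : IsState ρ) : IsState (traceB ρ) := by
  refine ⟨?_, by rw [trace_traceB]; exact hρ.2⟩
  have h : traceB ρ = ∑ k, ρ.submatrix (fun i => (i, k)) (fun i => (i, k)) := by
    ext i j
    simp [traceB, Matrix.sum_apply]
  rw [h]
  exact Matrix.posSemidef_sum _ fun k _ => hρ.1.submatrix _

variable [DecidableEq b]

lemma kronecker_one_mul_apply (Y : Matrix a a ℂ) (B : Matrix (a × b) (a × b) ℂ) (i : a) (k : b)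
    (p : a × b) : ((Y ⊗ₖ (1 : Matrix b b ℂ)) * B) (i, k) p = ∑ i', Y i i' * B (i', k) p := by
  rw [Matrix.mul_apply, Fintype.sum_prod_type]
  refine Finset.sum_congr rfl fun i' _ => ?_
  rw [Finset.sum_eq_single k]
  · simp [Matrix.kroneckerMap_apply]
  · intro l _ hl
    simp [Matrix.kroneckerMap_apply, Matrix.one_apply_ne hl.symm]
  · simp

lemma trace_kronecker_one_mul (Y : Matrix a a ℂ) (B : Matrix (a × b) (a × b) ℂ) :
    ((Y ⊗ₖ (1 : Matrix b b ℂ)) * B).trace = (Y * traceB B).trace := by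
  simp only [Matrix.trace, Matrix.diag_apply, Fintype.sum_prod_type, kronecker_one_mul_apply]
  refine Finset.sum_congr rfl fun i _ => ?_
  rw [Finset.sum_comm]
  simp only [Matrix.mul_apply, traceB, Matrix.of_apply, Finset.mul_sum]

lemma frobSq_kronecker_one (A : Matrix a a ℂ) :
    frobSq (A ⊗ₖ (1 : Matrix b b ℂ)) = Fintype.card b * frobSq A := by
  have h := trace_kronecker_one_mul A ((A ⊗ₖ (1 : Matrix b b ℂ)).conjTranspose)
  rw [trace_mul_conjTranspose] at h
  have h2 : traceB ((A ⊗ₖ (1 : Matrix b b ℂ)).conjTranspose) =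
      (Fintype.card b : ℂ) • A.conjTranspose := by
    ext i j
    simp [traceB, Matrix.kroneckerMap_apply]
  rw [h2, mul_smul_comm, Matrix.trace_smul, trace_mul_conjTranspose, smul_eq_mul] at h
  exact_mod_cast h

variable [DecidableEq a]

/-- `Z ⊗ I` acts separately on each slice with a fixed column and a fixed second-factor index. Only
the dimension of the first factor is lost. -/
lemma integral_frobSq_kronecker_one_mul_le {Ω : Type*} [TopologicalSpace Ω] [CompactSpace Ω]
    [MeasurableSpace Ω] [OpensMeasurableSpace Ω] {P : Measure Ω} [IsFiniteMeasure P]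
    {Z : Ω → Matrix a a ℂ} (hZ : Continuous Z) {v : ℝ}
    (h : ∀ A, ∫ y, ‖(Z y * A).trace‖ ^ 2 ∂P ≤ v * frobSq A) (A : Matrix (a × b) (a × b) ℂ) :
    ∫ y, frobSq ((Z y ⊗ₖ (1 : Matrix b b ℂ)) * A) ∂P ≤ v * Fintype.card a * frobSq A := by
  have h1 : ∀ y, frobSq ((Z y ⊗ₖ (1 : Matrix b b ℂ)) * A) =
      ∑ p, ∑ k, ∑ i, ‖∑ i', Z y i i' * A (i', k) p‖ ^ 2 := by
    intro y
    rw [frobSq, Finset.sum_comm]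
    refine Finset.sum_congr rfl fun p _ => ?_
    rw [Fintype.sum_prod_type, Finset.sum_comm]
    simp only [kronecker_one_mul_apply]
  have hi : ∀ (p : a × b) (k : b),
      Integrable (fun y => ∑ i, ‖∑ i', Z y i i' * A (i', k) p‖ ^ 2) P := fun p k =>
    integrable_finsetSum _ fun i _ => integrable_norm_mul_sq hZ i fun i' => A (i', k) p
  simp only [h1]
  rw [integral_finsetSum _ fun p _ => integrable_finsetSum _ fun k _ => hi p k, frobSq,
    Finset.sum_comm, Finset.mul_sum]
  refine Finset.sum_le_sum fun p _ => ?_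
  rw [integral_finsetSum _ fun k _ => hi p k, Fintype.sum_prod_type, Finset.sum_comm,
    Finset.mul_sum]
  exact Finset.sum_le_sum fun k _ => integral_sum_norm_mul_sq_le hZ h fun i' => A (i', k) p

variable [TopologicalSpace a] [DiscreteTopology a] [MeasurableSpace a] [OpensMeasurableSpace a]
  {ν : Measure (Matrix.unitaryGroup a ℂ)} [IsProbabilityMeasure ν] {ρ : Matrix a a ℂ}

/-- A functional of `Z ⊗ I` is a functional of `Z` evaluated at a partial trace. The partial trace
can raise the squared norm by `card b`, which is the extra factor in the first constant. -/
theorem isNoise_shadow_kronecker_one (b : Type*) [Fintype b] [DecidableEq b] (hρ : IsState ρ)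
    (hν : IsUnitaryDesign 3 ν) :
    IsNoise (runLaw ν ρ) (fun x => (shadow x - ρ) ⊗ₖ (1 : Matrix b b ℂ)) (4 * Fintype.card b)
      (4 * Fintype.card a) := by
  have := isProbabilityMeasure_runLaw (ν := ν) hρ
  refine ⟨?_, fun A => ?_, fun A => ?_,
    integral_frobSq_kronecker_one_mul_le (continuous_shadow_sub ρ)
      (integral_norm_trace_shadow_sub_sq_le hρ hν)⟩
  · refine continuous_matrix fun p q => ?_
    exact ((continuous_shadow_sub ρ).matrix_elem p.1 q.1).mul continuous_const
  · simp only [trace_kronecker_one_mul]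
    exact integral_trace_shadow_sub hρ hν _
  · simp only [trace_kronecker_one_mul]
    refine (integral_norm_trace_shadow_sub_sq_le hρ hν _).trans ?_
    rw [mul_assoc]
    exact mul_le_mul_of_nonneg_left (frobSq_traceB_le A) (by norm_num)

end PartialTrace

/-! ### Noise terms with two and three slots -/

section Expansion

variable {m : Type*} [Fintype m] [DecidableEq m] {J : Type*} {Ω : J → Type*}
  {Z : ∀ j, Ω j → Matrix m m ℂ}

lemma noiseTerm_two (C : Fin 2 → Matrix m m ℂ) (a : Finset (Fin 2)) (T : Fin 2 → J)
    (x : ∀ j, Ω j) :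
    noiseTerm Z C a T x = ((if 0 ∈ a then Z (T 0) (x (T 0)) else C 0) *
      (if 1 ∈ a then Z (T 1) (x (T 1)) else C 1)).trace := by
  simp [noiseTerm, traceProd_apply, Finset.piecewise, List.ofFn_succ]

lemma noiseTerm_three (C : Fin 3 → Matrix m m ℂ) (a : Finset (Fin 3)) (T : Fin 3 → J)
    (x : ∀ j, Ω j) :
    noiseTerm Z C a T x = ((if 0 ∈ a then Z (T 0) (x (T 0)) else C 0) *
      ((if 1 ∈ a then Z (T 1) (x (T 1)) else C 1) *
      (if 2 ∈ a then Z (T 2) (x (T 2)) else C 2))).trace := by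
  simp [noiseTerm, traceProd_apply, Finset.piecewise, List.ofFn_succ]

lemma card_eq_sum_ite {r : ℕ} (a : Finset (Fin r)) : a.card = ∑ s, if s ∈ a then 1 else 0 := by
  simp

end Expansion

/-! ### Second moments of individual noise terms -/

section TermBounds

variable {m : Type*} [Fintype m] {J : Type*} [Fintype J] [DecidableEq J]
  {Ω : J → Type*} [∀ j, MeasurableSpace (Ω j)] {P : ∀ j, Measure (Ω j)}
  [∀ j, IsProbabilityMeasure (P j)] [∀ j, TopologicalSpace (Ω j)] [∀ j, CompactSpace (Ω j)]
  [∀ j, SecondCountableTopology (Ω j)] [∀ j, OpensMeasurableSpace (Ω j)]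
  {Z : ∀ j, Ω j → Matrix m m ℂ} {i j k : J} {v w v' w' v'' w'' : ℝ}

lemma IsNoise.integral_norm_trace_one_le (hi : IsNoise (P i) (Z i) v w) (A : Matrix m m ℂ) :
    ∫ x, ‖(Z i (x i) * A).trace‖ ^ 2 ∂(Measure.pi P) ≤ v * frobSq A := by
  simpa using hi.pi_trace_sq_le (R := fun _ => A) continuous_const fun _ _ => rfl

lemma IsNoise.integral_norm_trace_two_le (hi : IsNoise (P i) (Z i) v w)
    (hj : IsNoise (P j) (Z j) v' w') (hv : 0 ≤ v) (hij : i ≠ j) (A : Matrix m m ℂ) :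
    ∫ x, ‖(Z i (x i) * (Z j (x j) * A)).trace‖ ^ 2 ∂(Measure.pi P) ≤ v * (w' * frobSq A) := by
  have hc : Continuous fun x : ∀ j, Ω j => Z j (x j) * A :=
    (hj.continuous.comp (continuous_apply j)).matrix_mul continuous_const
  refine (hi.pi_trace_sq_le (R := fun x => Z j (x j) * A) hc fun x y => ?_).trans ?_
  · simp only [Function.update_of_ne hij.symm]
  · refine mul_le_mul_of_nonneg_left ?_ hv
    simpa using hj.pi_mul_le (R := fun _ => A) continuous_const fun _ _ => rfl

/-- Runs are integrated out from the left: the first noise matrix acts as a functional (cost `v`),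
the later ones as left multipliers (costs `w'`, `w''`). -/
lemma IsNoise.integral_norm_trace_three_le (hi : IsNoise (P i) (Z i) v w)
    (hj : IsNoise (P j) (Z j) v' w') (hk : IsNoise (P k) (Z k) v'' w'') (hv : 0 ≤ v) (hw : 0 ≤ w')
    (hij : i ≠ j) (hik : i ≠ k) (hjk : j ≠ k) (A : Matrix m m ℂ) :
    ∫ x, ‖(Z i (x i) * (Z j (x j) * (Z k (x k) * A))).trace‖ ^ 2 ∂(Measure.pi P) ≤
      v * (w' * (w'' * frobSq A)) := by
  have hc : Continuous fun x : ∀ j, Ω j => Z k (x k) * A :=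
    (hk.continuous.comp (continuous_apply k)).matrix_mul continuous_const
  have hc' : Continuous fun x : ∀ j, Ω j => Z j (x j) * (Z k (x k) * A) :=
    (hj.continuous.comp (continuous_apply j)).matrix_mul hc
  refine (hi.pi_trace_sq_le (R := fun x => Z j (x j) * (Z k (x k) * A)) hc' fun x y => ?_).trans ?_
  · simp only [Function.update_of_ne hij.symm, Function.update_of_ne hik.symm]
  refine mul_le_mul_of_nonneg_left ?_ hv
  refine (hj.pi_mul_le (R := fun x => Z k (x k) * A) hc fun x y => ?_).trans ?_
  · simp only [Function.update_of_ne hjk.symm]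
  refine mul_le_mul_of_nonneg_left ?_ hw
  simpa using hk.pi_mul_le (R := fun _ => A) continuous_const fun _ _ => rfl

variable [DecidableEq m]

lemma integral_norm_noiseTerm_two_le {C : Fin 2 → Matrix m m ℂ} (hm : 1 ≤ Fintype.card m)
    (hC : ∀ s, frobSq (C s) ≤ 1) {T : Fin 2 → J} (hT : Function.Injective T)
    (hZ : ∀ s, IsNoise (P (T s)) (Z (T s)) 4 (4 * Fintype.card m)) {a : Finset (Fin 2)}
    (ha : a.Nonempty) :
    ∫ x, ‖noiseTerm Z C a T x‖ ^ 2 ∂(Measure.pi P) ≤ 64 * (Fintype.card m : ℝ) ^ a.card := by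
  have hm' : (1 : ℝ) ≤ Fintype.card m := by exact_mod_cast hm
  simp only [noiseTerm_two]
  rw [card_eq_sum_ite a, Fin.sum_univ_two]
  have h01 : T 0 ≠ T 1 := hT.ne (by decide)
  by_cases h0 : 0 ∈ a <;> by_cases h1 : 1 ∈ a <;>
    simp only [h0, h1, if_true, if_false, add_zero, zero_add, pow_one,
      Nat.reduceAdd]
  -- With noise in every slot the remaining matrix is the identity, whose squared norm supplies the
  -- last factor of the dimension.
  · refine le_trans ?_ (((hZ 0).integral_norm_trace_two_le (hZ 1) (by norm_num) h01 1).trans ?_)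
    · simp
    · rw [frobSq_one]
      nlinarith [sq_nonneg (Fintype.card m : ℝ)]
  · refine ((hZ 0).integral_norm_trace_one_le _).trans ?_
    nlinarith [hC 1]
  · simp only [Matrix.trace_mul_comm (C 0)]
    refine ((hZ 1).integral_norm_trace_one_le _).trans ?_
    nlinarith [hC 0]
  · obtain ⟨s, hs⟩ := ha
    fin_cases s <;> contradiction

lemma integral_norm_noiseTerm_three_le {C : Fin 3 → Matrix m m ℂ} (hm : 1 ≤ Fintype.card m)
    (hC0 : frobSq (C 0) ≤ Fintype.card m) (hC1 : frobSq (C 1) ≤ 1) (hC2 : frobSq (C 2) ≤ 1)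
    {T : Fin 3 → J} (hT : Function.Injective T)
    (hZ0 : IsNoise (P (T 0)) (Z (T 0)) (4 * Fintype.card m) (4 * Fintype.card m))
    (hZ1 : IsNoise (P (T 1)) (Z (T 1)) 4 (4 * Fintype.card m))
    (hZ2 : IsNoise (P (T 2)) (Z (T 2)) 4 (4 * Fintype.card m)) {a : Finset (Fin 3)}
    (ha : a.Nonempty) :
    ∫ x, ‖noiseTerm Z C a T x‖ ^ 2 ∂(Measure.pi P) ≤ 64 * (Fintype.card m : ℝ) ^ a.card := by
  have hm' : (1 : ℝ) ≤ Fintype.card m := by exact_mod_cast hm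
  simp only [noiseTerm_three]
  rw [card_eq_sum_ite a, Fin.sum_univ_three]
  have h01 : T 0 ≠ T 1 := hT.ne (by decide)
  have h02 : T 0 ≠ T 2 := hT.ne (by decide)
  have h12 : T 1 ≠ T 2 := hT.ne (by decide)
  have p0 := frobSq_nonneg (C 0)
  have p1 := frobSq_nonneg (C 1)
  have p2 := frobSq_nonneg (C 2)
  have q12 : frobSq (C 1 * C 2) ≤ 1 := (frobSq_mul_le _ _).trans (by nlinarith)
  have q20 : frobSq (C 2 * C 0) ≤ Fintype.card m := (frobSq_mul_le _ _).trans (by nlinarith)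
  have q01 : frobSq (C 0 * C 1) ≤ Fintype.card m := (frobSq_mul_le _ _).trans (by nlinarith)
  have hv : (0 : ℝ) ≤ 4 * Fintype.card m := by positivity
  by_cases h0 : 0 ∈ a <;> by_cases h1 : 1 ∈ a <;> by_cases h2 : 2 ∈ a <;>
    simp only [h0, h1, h2, if_true, if_false, add_zero, zero_add, pow_one,
      Nat.reduceAdd]
  -- The extremal case: with `D = card m` the product is `4 * 4D * 4D * D = 64 D³`. Starting from
  -- slot 0 would cost one more factor `D`.
  · refine le_trans ?_ ((hZ2.integral_norm_trace_three_le hZ0 hZ1 (by norm_num) hv h02.symm h12.symm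
      h01 1).trans ?_)
    · simp only [mul_one]
      refine le_of_eq (integral_congr_ae (Filter.Eventually.of_forall fun x => ?_))
      simp only
      rw [Matrix.trace_mul_comm (Z (T 2) _), mul_assoc]
    · rw [frobSq_one]
      refine le_of_eq ?_
      ring
  · refine (hZ0.integral_norm_trace_two_le hZ1 hv h01 _).trans ?_
    nlinarith [mul_le_mul_of_nonneg_left hC2 (sq_nonneg (Fintype.card m : ℝ)),
      sq_nonneg (Fintype.card m : ℝ)]
  · refine le_trans (le_of_eq (integral_congr_ae (Filter.Eventually.of_forall fun x => ?_)))
      ((hZ2.integral_norm_trace_two_le hZ0 (by norm_num) h02.symm (C 1)).trans ?_)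
    · simp only
      rw [Matrix.trace_mul_comm (Z (T 2) _), mul_assoc]
    · nlinarith [mul_le_mul_of_nonneg_left hC1 hv, mul_le_mul_of_nonneg_left hm' hv]
  · refine (hZ0.integral_norm_trace_one_le _).trans ?_
    nlinarith
  · refine le_trans (le_of_eq (integral_congr_ae (Filter.Eventually.of_forall fun x => ?_)))
      ((hZ1.integral_norm_trace_two_le hZ2 (by norm_num) h12 (C 0)).trans ?_)
    · simp only
      rw [Matrix.trace_mul_comm (C 0), mul_assoc]
    · nlinarith [mul_le_mul_of_nonneg_left hC0 hv, sq_nonneg (Fintype.card m : ℝ)]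
  · refine le_trans (le_of_eq (integral_congr_ae (Filter.Eventually.of_forall fun x => ?_)))
      ((hZ1.integral_norm_trace_one_le (C 2 * C 0)).trans ?_)
    · simp only
      rw [Matrix.trace_mul_comm (C 0), mul_assoc]
    · nlinarith
  · refine le_trans (le_of_eq (integral_congr_ae (Filter.Eventually.of_forall fun x => ?_)))
      ((hZ2.integral_norm_trace_one_le (C 0 * C 1)).trans ?_)
    · simp only
      rw [Matrix.trace_mul_comm (Z (T 2) _), mul_assoc]
    · nlinarith
  · obtain ⟨s, hs⟩ := ha
    fin_cases s <;> contradiction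

end TermBounds

/-! ### The second and third moment estimators -/

section Estimators

lemma estimatesWithin_of_re {X : Type*} [TopologicalSpace X] [CompactSpace X] [MeasurableSpace X]
    [OpensMeasurableSpace X] {μ : Measure X} [IsProbabilityMeasure μ] {f : X → ℂ}
    (hf : Continuous f) {g : X → ℝ} (hg : ∀ x, g x = (f x).re) {θ : ℂ} {ε : ℝ}
    (hmean : ∫ x, f x ∂μ = θ) (hvar : ∫ x, ‖f x - θ‖ ^ 2 ∂μ ≤ ε ^ 2) :
    EstimatesWithin μ g θ.re ε := by
  obtain rfl : g = fun x => (f x).re := funext hg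
  have hc : Continuous fun x => (f x).re := Complex.continuous_re.comp hf
  have hi : Integrable f μ := integrable_of_continuous hf
  have hm : ∫ x, (f x).re ∂μ = θ.re := by
    have := integral_re hi
    rw [hmean] at this
    exact this
  refine ⟨?_, hm, ?_⟩
  · obtain ⟨K, hK⟩ := isCompact_univ.exists_bound_of_continuousOn hc.continuousOn
    exact MemLp.of_bound hc.aestronglyMeasurable K
      (Filter.Eventually.of_forall fun x => hK x trivial)
  · rw [variance_eq_integral hc.aemeasurable, hm]
    refine le_trans (integral_mono (integrable_of_continuous ((hc.sub continuous_const).pow 2))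
      (integrable_of_continuous ((hf.sub continuous_const).norm.pow 2)) fun x => ?_) hvar
    have h := Complex.abs_re_le_norm (f x - θ)
    rw [Complex.sub_re] at h
    exact sq_le_sq.2 (h.trans (le_abs_self _))

lemma sum_Ioi_eq_sum_filter {E : Type*} [AddCommMonoid E] {M : ℕ} (g : Fin M → Fin M → E) :
    ∑ j, ∑ k ∈ Finset.Ioi j, g j k =
      ∑ p ∈ (Finset.univ : Finset (Fin M × Fin M)).filter (fun p => p.1 < p.2), g p.1 p.2 := by
  rw [Finset.sum_filter, Fintype.sum_prod_type]
  refine Finset.sum_congr rfl fun j _ => ?_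
  rw [← Finset.sum_filter]
  exact Finset.sum_congr (by ext; simp) fun _ _ => rfl

lemma sum_Ioi_Ioi_eq_sum_filter {E : Type*} [AddCommMonoid E] {M : ℕ}
    (g : Fin M → Fin M → Fin M → E) :
    ∑ i, ∑ j ∈ Finset.Ioi i, ∑ k ∈ Finset.Ioi j, g i j k =
      ∑ p ∈ (Finset.univ : Finset (Fin M × Fin M × Fin M)).filter
        (fun p => p.1 < p.2.1 ∧ p.2.1 < p.2.2), g p.1 p.2.1 p.2.2 := by
  rw [Finset.sum_filter, Fintype.sum_prod_type]
  refine Finset.sum_congr rfl fun i _ => ?_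
  rw [Fintype.sum_prod_type]
  have h : Finset.Ioi i = Finset.univ.filter fun j => i < j := by ext; simp
  rw [h, Finset.sum_filter]
  refine Finset.sum_congr rfl fun j _ => ?_
  have h' : Finset.Ioi j = Finset.univ.filter fun k => j < k := by ext; simp
  by_cases hij : i < j
  · simp only [hij, if_true, true_and]
    rw [h', Finset.sum_filter]
  · simp [hij]

lemma sum_card_Ioi (M : ℕ) : ∑ j : Fin M, ∑ _k ∈ Finset.Ioi j, 1 = M.choose 2 := by
  induction M with
  | zero => simp
  | succ M ih =>
    rw [Fin.sum_univ_succ, Fin.sum_Ioi_zero]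
    simp only [Fin.sum_Ioi_succ, ih]
    simp [Nat.choose_succ_succ']

lemma sum_card_Ioi_Ioi (M : ℕ) :
    ∑ i : Fin M, ∑ j ∈ Finset.Ioi i, ∑ _k ∈ Finset.Ioi j, 1 = M.choose 3 := by
  induction M with
  | zero => simp
  | succ M ih =>
    rw [Fin.sum_univ_succ, Fin.sum_Ioi_zero]
    simp only [Fin.sum_Ioi_succ, ih, sum_card_Ioi]
    rw [Nat.choose_succ_succ']

lemma card_filter_lt (M : ℕ) :
    ((Finset.univ : Finset (Fin M × Fin M)).filter (fun p => p.1 < p.2)).card = M.choose 2 := by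
  rw [Finset.card_eq_sum_ones, ← sum_Ioi_eq_sum_filter fun _ _ => 1, sum_card_Ioi]

lemma card_filter_lt_lt (M : ℕ) :
    ((Finset.univ : Finset (Fin M × Fin M × Fin M)).filter
      (fun p => p.1 < p.2.1 ∧ p.2.1 < p.2.2)).card = M.choose 3 := by
  rw [Finset.card_eq_sum_ones, ← sum_Ioi_Ioi_eq_sum_filter fun _ _ _ => 1, sum_card_Ioi_Ioi]

lemma sq_le_mul_choose_two {M : ℕ} (hM : 3 ≤ M) : (M : ℝ) ^ 2 ≤ 27 * M.choose 2 := by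
  rw [Nat.cast_choose_two]
  have : (3 : ℝ) ≤ M := by exact_mod_cast hM
  nlinarith

/-- The constant 27 is attained at `M = 3`. The same value serves as `q` for every estimator. -/
lemma cube_le_mul_choose_three {M : ℕ} (hM : 3 ≤ M) : (M : ℝ) ^ 3 ≤ 27 * M.choose 3 := by
  obtain ⟨k, rfl⟩ := Nat.exists_eq_add_of_le hM
  have h := Nat.descFactorial_eq_factorial_mul_choose (3 + k) 3
  have h1 : (3 + k).descFactorial 3 = (k + 1) * (k + 2) * (k + 3) := by
    simp only [Nat.descFactorial]
    have e1 : 3 + k - 2 = k + 1 := by omega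
    have e2 : 3 + k - 1 = k + 2 := by omega
    have e3 : 3 + k - 0 = k + 3 := by omega
    rw [e1, e2, e3]; ring
  rw [h1] at h
  have h2 : ((k : ℝ) + 1) * (k + 2) * (k + 3) = 6 * ((3 + k).choose 3 : ℝ) := by
    have : (((k + 1) * (k + 2) * (k + 3) : ℕ) : ℝ) =
        ((Nat.factorial 3 * (3 + k).choose 3 : ℕ) : ℝ) := by
      rw [h]
    push_cast [Nat.factorial] at this
    linarith
  have hk : (0 : ℝ) ≤ k := Nat.cast_nonneg k
  push_cast
  nlinarith [mul_nonneg hk hk, mul_nonneg (mul_nonneg hk hk) hk]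

lemma injective_vecCons_three {α : Type*} {x y z : α} (hxy : x ≠ y) (hxz : x ≠ z) (hyz : y ≠ z) :
    Function.Injective ![x, y, z] := by
  intro s t hst
  fin_cases s <;> fin_cases t <;> simp_all [hxy.symm, hxz.symm, hyz.symm]

lemma three_le_of_mul_le {N C M : ℕ} (hN : 1 ≤ N) (hC : 3 ≤ C) (hM : C * N ≤ M) : 3 ≤ M :=
  hC.trans ((Nat.le_mul_of_pos_right C hN).trans hM)

variable {n : Type*} [Fintype n] [DecidableEq n]

/-- The average of `Tr(ρ̂_i ρ̂_j ρ̂_k)` over a finite family of triples of runs. -/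
def tripleMean {M : ℕ} {I : Type*} (F : Finset I) (τ : I → Fin 3 → Fin M)
    (x : Fin M → Matrix.unitaryGroup n ℂ × n) : ℂ :=
  (F.card : ℂ)⁻¹ * ∑ p ∈ F, (shadow (x (τ p 0)) * shadow (x (τ p 1)) * shadow (x (τ p 2))).trace

lemma tripleMean_eq (ρ : Matrix n n ℂ) {M : ℕ} {I : Type*} (F : Finset I) (τ : I → Fin 3 → Fin M)
    (x : Fin M → Matrix.unitaryGroup n ℂ × n) :
    tripleMean F τ x = (F.card : ℂ)⁻¹ *
      ∑ p ∈ F, traceProd n 3 (fun s => (shadow (x (τ p s)) - ρ) + ρ) := by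
  rw [tripleMean]
  congr 1
  refine Finset.sum_congr rfl fun p _ => ?_
  simp [traceProd_apply, List.ofFn_succ, mul_assoc]

lemma traceProd_three_const (ρ : Matrix n n ℂ) : traceProd n 3 (fun _ => ρ) = (ρ ^ 3).trace := by
  simp [traceProd_apply, List.ofFn_succ, pow_succ, mul_assoc]

variable [TopologicalSpace n] [DiscreteTopology n]

lemma continuous_tripleMean {M : ℕ} {I : Type*} (F : Finset I) (τ : I → Fin 3 → Fin M) :
    Continuous (tripleMean F τ : (Fin M → Matrix.unitaryGroup n ℂ × n) → ℂ) := by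
  have h : ∀ k : Fin M, Continuous fun x : Fin M → Matrix.unitaryGroup n ℂ × n => shadow (x k) :=
    fun k => continuous_shadow.comp (continuous_apply k)
  exact continuous_const.mul (continuous_finsetSum _ fun p _ =>
    (((h _).matrix_mul (h _)).matrix_mul (h _)).matrix_trace)

variable [MeasurableSpace n] [OpensMeasurableSpace n]
  {ν : Measure (Matrix.unitaryGroup n ℂ)} [IsProbabilityMeasure ν] {ρ : Matrix n n ℂ}

theorem estimatesWithin_estSecond (hρ : IsState ρ) (hν : IsUnitaryDesign 3 ν) {ε : ℝ} {C M : ℕ}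
    (hC3 : 3 ≤ C) (hC : 3000000 / (C : ℝ) ≤ ε ^ 2) (hM : C * Fintype.card n ≤ M) :
    EstimatesWithin (dataLaw ν ρ M) estSecond ((ρ ^ 2).trace).re ε := by
  have hP := isProbabilityMeasure_runLaw (ν := ν) hρ
  have hn : 1 ≤ Fintype.card n := card_pos_of_isState hρ
  have hM3 : 3 ≤ M := three_le_of_mul_le hn hC3 hM
  have hCr : (3 : ℝ) ≤ C := by exact_mod_cast hC3
  have hnoise := isNoise_shadow hρ hν
  set F : Finset (Fin M × Fin M) := Finset.univ.filter fun p => p.1 < p.2 with hF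
  let τ : Fin M × Fin M → Fin 2 → Fin M := fun p => ![p.1, p.2]
  let K : Fin 2 → Matrix n n ℂ := fun _ => ρ
  let Z : Fin M → Matrix.unitaryGroup n ℂ × n → Matrix n n ℂ := fun _ x => shadow x - ρ
  have hcard : F.card = M.choose 2 := card_filter_lt M
  have hFne : F.Nonempty := by
    rw [← Finset.card_pos, hcard]
    exact Nat.choose_pos (by omega)
  have hτ : ∀ p ∈ F, Function.Injective (τ p) := by
    intro p hp
    have hlt : p.1 < p.2 := (Finset.mem_filter.1 hp).2
    intro s t hst
    fin_cases s <;> fin_cases t <;> simp_all [τ, hlt.ne, hlt.ne']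
  have hinj : Set.InjOn τ F := by
    intro p _ p' _ h
    exact Prod.ext (congr_fun h 0) (congr_fun h 1)
  have hθ : traceProd n 2 K = (ρ ^ 2).trace := by
    simp [traceProd_apply, K, List.ofFn_succ, sq]
  have hf : ∀ x : Fin M → Matrix.unitaryGroup n ℂ × n, estSecond x =
      ((F.card : ℂ)⁻¹ * ∑ p ∈ F, traceProd n 2 (fun s => Z (τ p s) (x (τ p s)) + K s)).re := by
    intro x
    have h1 : ∀ p : Fin M × Fin M, traceProd n 2 (fun s => Z (τ p s) (x (τ p s)) + K s) =
        (shadow (x p.1) * shadow (x p.2)).trace := by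
      intro p
      simp [traceProd_apply, K, Z, τ, List.ofFn_succ]
    simp only [h1]
    rw [← sum_Ioi_eq_sum_filter (fun j k => (shadow (x j) * shadow (x k)).trace), hcard, estSecond]
    have h2 : ((M.choose 2 : ℕ) : ℂ)⁻¹ = (((M.choose 2 : ℝ)⁻¹ : ℝ) : ℂ) := by push_cast; rfl
    rw [h2, Complex.re_ofReal_mul, Complex.re_sum]
    simp only [Complex.re_sum]
  rw [← hθ, dataLaw]
  have hcont : Continuous fun x : Fin M → Matrix.unitaryGroup n ℂ × n =>
      (F.card : ℂ)⁻¹ * ∑ p ∈ F, traceProd n 2 (fun s => Z (τ p s) (x (τ p s)) + K s) :=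
    continuous_const.mul (continuous_finsetSum _ fun p _ => (continuous_traceProd 2).comp
      (continuous_pi fun s => ((continuous_shadow_sub ρ).comp (continuous_apply _)).add
        continuous_const))
  have hMn : (C : ℝ) * Fintype.card n ≤ M := by exact_mod_cast hM
  refine estimatesWithin_of_re hcont hf (integral_mean_traceProd (Z := Z) (C := K)
    (fun _ => hnoise.continuous) (fun _ => hnoise.integral_trace) hFne hτ) ?_
  refine (integral_norm_mean_traceProd_sub_sq_le (Z := Z) (C := K) (N := fun _ => Finset.univ)
    (B := 64) (D := Fintype.card n) (c := C) (q := 27)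
    (fun _ => hnoise.continuous) (fun _ => hnoise.integral_trace) hFne hτ hinj
    (fun _ _ _ => Finset.mem_univ _) (by norm_num) (by exact_mod_cast hn) (by linarith)
    (by norm_num) (fun a ha p hp => integral_norm_noiseTerm_two_le hn
      (fun _ => hρ.frobSq_le_one) (hτ p hp) (fun _ => hnoise) ha) ?_ ?_).trans ?_
  · rw [hcard]
    simpa using sq_le_mul_choose_two hM3
  · intro s
    simpa using hMn
  · refine le_trans ?_ hC
    rw [← mul_div_assoc]
    exact div_le_div_of_nonneg_right (by norm_num) (by linarith)

lemma integral_tripleMean (hρ : IsState ρ) (hν : IsUnitaryDesign 3 ν) {M : ℕ} {I : Type*}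
    {F : Finset I} (hF : F.Nonempty) {τ : I → Fin 3 → Fin M}
    (hτ : ∀ p ∈ F, Function.Injective (τ p)) :
    ∫ x, tripleMean F τ x ∂(dataLaw ν ρ M) = (ρ ^ 3).trace := by
  have hP := isProbabilityMeasure_runLaw (ν := ν) hρ
  have hnoise := isNoise_shadow hρ hν
  simp only [tripleMean_eq ρ]
  rw [← traceProd_three_const, dataLaw]
  exact integral_mean_traceProd (C := fun _ => ρ)
    (Z := fun (_ : Fin M) (x : Matrix.unitaryGroup n ℂ × n) => shadow x - ρ)
    (fun _ => hnoise.continuous) (fun _ => hnoise.integral_trace) hF hτ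

lemma integral_norm_tripleMean_sub_sq_le (hρ : IsState ρ) (hν : IsUnitaryDesign 3 ν) {ε : ℝ}
    {C M : ℕ} (hC3 : 3 ≤ C) (hC : 3000000 / (C : ℝ) ≤ ε ^ 2) (hM : C * Fintype.card n ≤ M)
    {I : Type*} {F : Finset I} (hcard : F.card = M.choose 3) {τ : I → Fin 3 → Fin M}
    (hτ : ∀ p ∈ F, Function.Injective (τ p)) (hinj : Set.InjOn τ F) :
    ∫ x, ‖tripleMean F τ x - (ρ ^ 3).trace‖ ^ 2 ∂(dataLaw ν ρ M) ≤ ε ^ 2 := by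
  have hP := isProbabilityMeasure_runLaw (ν := ν) hρ
  have hn : 1 ≤ Fintype.card n := card_pos_of_isState hρ
  have hM3 : 3 ≤ M := three_le_of_mul_le hn hC3 hM
  have hCr : (3 : ℝ) ≤ C := by exact_mod_cast hC3
  have hnr : (1 : ℝ) ≤ Fintype.card n := by exact_mod_cast hn
  have hnoise := isNoise_shadow hρ hν
  have hMn : (C : ℝ) * Fintype.card n ≤ M := by exact_mod_cast hM
  have hF : F.Nonempty := by
    rw [← Finset.card_pos, hcard]
    exact Nat.choose_pos hM3
  have hq : (∏ _s : Fin 3, ((Finset.univ : Finset (Fin M)).card : ℝ)) ≤ 27 * F.card := by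
    rw [hcard]
    simpa using cube_le_mul_choose_three hM3
  simp only [tripleMean_eq ρ]
  rw [← traceProd_three_const, dataLaw]
  refine (integral_norm_mean_traceProd_sub_sq_le (C := fun _ => ρ)
    (Z := fun (_ : Fin M) (x : Matrix.unitaryGroup n ℂ × n) => shadow x - ρ)
    (N := fun _ => Finset.univ) (B := 64) (D := Fintype.card n) (c := C) (q := 27)
    (fun _ => hnoise.continuous) (fun _ => hnoise.integral_trace) hF hτ hinj
    (fun _ _ _ => Finset.mem_univ _) (by norm_num) (by linarith) (by linarith)
    (by norm_num) (fun a ha p hp => ?_) hq (fun s => by simpa using hMn)).trans ?_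
  -- Here slot 0 satisfies better bounds than required; `IsNoise.mono` weakens them to the common
  -- form.
  · exact integral_norm_noiseTerm_three_le (C := fun _ => ρ) (T := τ p)
      (Z := fun (_ : Fin M) (x : Matrix.unitaryGroup n ℂ × n) => shadow x - ρ)
      (P := fun _ => runLaw ν ρ) hn (hρ.frobSq_le_one.trans hnr) hρ.frobSq_le_one
      hρ.frobSq_le_one (hτ p hp) (hnoise.mono (by linarith) le_rfl) hnoise hnoise ha
  · refine le_trans ?_ hC
    rw [← mul_div_assoc]
    exact div_le_div_of_nonneg_right (by norm_num) (by linarith)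

/-- The estimator is the real part of the mean of two triple averages, one for each order of the
first two factors. Both are unbiased with the same variance bound, and convexity of the square
carries the bound to their mean. -/
theorem estimatesWithin_estThird (hρ : IsState ρ) (hν : IsUnitaryDesign 3 ν) {ε : ℝ} {C M : ℕ}
    (hC3 : 3 ≤ C) (hC : 3000000 / (C : ℝ) ≤ ε ^ 2) (hM : C * Fintype.card n ≤ M) :
    EstimatesWithin (dataLaw ν ρ M) estThird ((ρ ^ 3).trace).re ε := by
  have hP := isProbabilityMeasure_runLaw (ν := ν) hρ
  have hPM : IsProbabilityMeasure (dataLaw ν ρ M) := by unfold dataLaw; infer_instance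
  set F : Finset (Fin M × Fin M × Fin M) :=
    Finset.univ.filter fun p => p.1 < p.2.1 ∧ p.2.1 < p.2.2 with hF
  have hcard : F.card = M.choose 3 := card_filter_lt_lt M
  have hn : 1 ≤ Fintype.card n := card_pos_of_isState hρ
  have hFne : F.Nonempty := by
    rw [← Finset.card_pos, hcard]
    exact Nat.choose_pos (three_le_of_mul_le hn hC3 hM)
  let τ₁ : Fin M × Fin M × Fin M → Fin 3 → Fin M := fun p => ![p.1, p.2.1, p.2.2]
  let τ₂ : Fin M × Fin M × Fin M → Fin 3 → Fin M := fun p => ![p.2.1, p.1, p.2.2]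
  have h₁ : ∀ p ∈ F, Function.Injective (τ₁ p) := fun p hp => by
    obtain ⟨h1, h2⟩ := (Finset.mem_filter.1 hp).2
    exact injective_vecCons_three h1.ne (h1.trans h2).ne h2.ne
  have h₂ : ∀ p ∈ F, Function.Injective (τ₂ p) := fun p hp => by
    obtain ⟨h1, h2⟩ := (Finset.mem_filter.1 hp).2
    exact injective_vecCons_three h1.ne' h2.ne (h1.trans h2).ne
  have hi₁ : Set.InjOn τ₁ F := fun p _ p' _ h =>
    Prod.ext (congr_fun h 0) (Prod.ext (congr_fun h 1) (congr_fun h 2))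
  have hi₂ : Set.InjOn τ₂ F := fun p _ p' _ h =>
    Prod.ext (congr_fun h 1) (Prod.ext (congr_fun h 0) (congr_fun h 2))
  have c1 := continuous_tripleMean (n := n) F τ₁
  have c2 := continuous_tripleMean (n := n) F τ₂
  have m1 := integral_tripleMean hρ hν hFne h₁
  have m2 := integral_tripleMean hρ hν hFne h₂
  have v1 := integral_norm_tripleMean_sub_sq_le hρ hν hC3 hC hM hcard h₁ hi₁
  have v2 := integral_norm_tripleMean_sub_sq_le hρ hν hC3 hC hM hcard h₂ hi₂
  have e1 : ∀ x : Fin M → Matrix.unitaryGroup n ℂ × n, tripleMean F τ₁ x = (M.choose 3 : ℂ)⁻¹ *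
      ∑ p ∈ F, (shadow (x p.1) * shadow (x p.2.1) * shadow (x p.2.2)).trace := fun x => by
    rw [tripleMean, hcard]; rfl
  have e2 : ∀ x : Fin M → Matrix.unitaryGroup n ℂ × n, tripleMean F τ₂ x = (M.choose 3 : ℂ)⁻¹ *
      ∑ p ∈ F, (shadow (x p.2.1) * shadow (x p.1) * shadow (x p.2.2)).trace := fun x => by
    rw [tripleMean, hcard]; rfl
  generalize tripleMean (n := n) F τ₁ = f1 at c1 m1 v1 e1
  generalize tripleMean (n := n) F τ₂ = f2 at c2 m2 v2 e2
  set θ := (ρ ^ 3).trace with hθ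
  refine estimatesWithin_of_re (f := fun x => (1 / 2 : ℂ) * (f1 x + f2 x))
    (continuous_const.mul (c1.add c2)) (fun x => ?_) ?_ ?_
  · rw [estThird,
      sum_Ioi_Ioi_eq_sum_filter (fun i j k => (shadow (x i) * shadow (x j) * shadow (x k)).trace),
      sum_Ioi_Ioi_eq_sum_filter (fun i j k => (shadow (x j) * shadow (x i) * shadow (x k)).trace)]
    have h2 : ((M.choose 3 : ℕ) : ℂ)⁻¹ = (((M.choose 3 : ℝ)⁻¹ : ℝ) : ℂ) := by push_cast; rfl
    have h3 : (1 / 2 : ℂ) = ((1 / 2 : ℝ) : ℂ) := by push_cast; rfl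
    rw [e1, e2, h2, h3, Complex.re_ofReal_mul, Complex.add_re, Complex.re_ofReal_mul,
      Complex.re_ofReal_mul]
    ring
  · rw [integral_const_mul, integral_add (integrable_of_continuous c1)
      (integrable_of_continuous c2), m1, m2]
    ring
  · have i1 : Integrable (fun x => ‖f1 x - θ‖ ^ 2) (dataLaw ν ρ M) :=
      integrable_of_continuous ((c1.sub continuous_const).norm.pow 2)
    have i2 : Integrable (fun x => ‖f2 x - θ‖ ^ 2) (dataLaw ν ρ M) :=
      integrable_of_continuous ((c2.sub continuous_const).norm.pow 2)
    calc ∫ x, ‖(1 / 2 : ℂ) * (f1 x + f2 x) - θ‖ ^ 2 ∂(dataLaw ν ρ M)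
        ≤ ∫ x, (1 / 2 : ℝ) * (‖f1 x - θ‖ ^ 2 + ‖f2 x - θ‖ ^ 2) ∂(dataLaw ν ρ M) := by
          refine integral_mono (integrable_of_continuous
            (((continuous_const.mul (c1.add c2)).sub continuous_const).norm.pow 2))
            ((i1.add i2).const_mul _) fun x => ?_
          have h : (1 / 2 : ℂ) * (f1 x + f2 x) - θ = (1 / 2 : ℂ) * ((f1 x - θ) + (f2 x - θ)) := by
            ring
          have h' := norm_add_le (f1 x - θ) (f2 x - θ)
          simp only
          rw [h, norm_mul, mul_pow]
          have h4 : ‖(1 / 2 : ℂ)‖ = 1 / 2 := by norm_num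
          rw [h4]
          nlinarith [sq_nonneg (‖f1 x - θ‖ - ‖f2 x - θ‖), norm_nonneg (f1 x - θ + (f2 x - θ)),
            norm_nonneg (f1 x - θ), norm_nonneg (f2 x - θ)]
      _ = 1 / 2 * (∫ x, ‖f1 x - θ‖ ^ 2 ∂(dataLaw ν ρ M) +
          ∫ x, ‖f2 x - θ‖ ^ 2 ∂(dataLaw ν ρ M)) := by
          rw [integral_const_mul, integral_add i1 i2]
      _ ≤ ε ^ 2 := by linarith

end Estimators

/-! ### Two independent batches as one product measure -/

section TwoBatches

universe u

/-- The sample spaces of `M` runs of one experiment and `L` runs of another. -/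
def BatchSpace (X Y : Type u) (M L : ℕ) : Fin M ⊕ Fin L → Type u
  | .inl _ => X
  | .inr _ => Y

variable {X Y : Type u} {M L : ℕ}

instance [TopologicalSpace X] [TopologicalSpace Y] :
    ∀ j, TopologicalSpace (BatchSpace X Y M L j)
  | .inl _ => inferInstanceAs (TopologicalSpace X)
  | .inr _ => inferInstanceAs (TopologicalSpace Y)

instance [MeasurableSpace X] [MeasurableSpace Y] : ∀ j, MeasurableSpace (BatchSpace X Y M L j)
  | .inl _ => inferInstanceAs (MeasurableSpace X)
  | .inr _ => inferInstanceAs (MeasurableSpace Y)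

instance [TopologicalSpace X] [TopologicalSpace Y] [CompactSpace X] [CompactSpace Y] :
    ∀ j, CompactSpace (BatchSpace X Y M L j)
  | .inl _ => inferInstanceAs (CompactSpace X)
  | .inr _ => inferInstanceAs (CompactSpace Y)

instance [TopologicalSpace X] [TopologicalSpace Y] [SecondCountableTopology X]
    [SecondCountableTopology Y] : ∀ j, SecondCountableTopology (BatchSpace X Y M L j)
  | .inl _ => inferInstanceAs (SecondCountableTopology X)
  | .inr _ => inferInstanceAs (SecondCountableTopology Y)

instance [TopologicalSpace X] [TopologicalSpace Y] [MeasurableSpace X] [MeasurableSpace Y]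
    [OpensMeasurableSpace X] [OpensMeasurableSpace Y] :
    ∀ j, OpensMeasurableSpace (BatchSpace X Y M L j)
  | .inl _ => inferInstanceAs (OpensMeasurableSpace X)
  | .inr _ => inferInstanceAs (OpensMeasurableSpace Y)

variable [MeasurableSpace X] [MeasurableSpace Y]

/-- The laws of the runs of two experiments. -/
def batchLaw (P : Measure X) (Q : Measure Y) (M L : ℕ) : ∀ j, Measure (BatchSpace X Y M L j)
  | .inl _ => P
  | .inr _ => Q

instance {P : Measure X} {Q : Measure Y} [hP : IsProbabilityMeasure P]
    [hQ : IsProbabilityMeasure Q] : ∀ j, IsProbabilityMeasure (batchLaw P Q M L j)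
  | .inl _ => hP
  | .inr _ => hQ

/-- Rewriting the product of two powers as one product over `Fin M ⊕ Fin L` brings the mixed
estimator under the general U-statistic bound, which allows the coordinates to have different spaces
and laws. -/
lemma integral_batchLaw {E : Type*} [NormedAddCommGroup E] [NormedSpace ℝ E]
    (P : Measure X) (Q : Measure Y) [IsProbabilityMeasure P] [IsProbabilityMeasure Q]
    (f : (Fin M → X) × (Fin L → Y) → E) :
    ∫ z, f z ∂((Measure.pi fun _ => P).prod (Measure.pi fun _ => Q)) =
      ∫ x : (∀ j, BatchSpace X Y M L j), f (fun i => x (.inl i), fun l => x (.inr l))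
        ∂(Measure.pi (batchLaw P Q M L)) :=
  ((measurePreserving_sumPiEquivProdPi (batchLaw P Q M L)).integral_comp' f).symm

end TwoBatches

/-! ### The estimator of `t₂` -/

section Bipartite

universe u

lemma sum_erase_eq_sum_filter {E : Type*} [AddCommMonoid E] {M L : ℕ}
    (g : Fin L → Fin M → Fin M → E) :
    ∑ l, ∑ i, ∑ j ∈ Finset.univ.erase i, g l i j =
      ∑ p ∈ (Finset.univ : Finset (Fin L × Fin M × Fin M)).filter
        (fun p => p.2.1 ≠ p.2.2), g p.1 p.2.1 p.2.2 := by
  rw [Finset.sum_filter, Fintype.sum_prod_type]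
  refine Finset.sum_congr rfl fun l _ => ?_
  rw [Fintype.sum_prod_type]
  refine Finset.sum_congr rfl fun i _ => ?_
  rw [← Finset.sum_filter]
  exact Finset.sum_congr (by ext; simp [eq_comm]) fun _ _ => rfl

lemma card_filter_ne (M L : ℕ) :
    ((Finset.univ : Finset (Fin L × Fin M × Fin M)).filter (fun p => p.2.1 ≠ p.2.2)).card =
      L * (M * (M - 1)) := by
  rw [Finset.card_eq_sum_ones, ← sum_erase_eq_sum_filter fun _ _ _ => 1]
  simp

variable {a b : Type u} [Fintype a] [DecidableEq a] [Fintype b] [DecidableEq b] {M L : ℕ}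

/-- The complex average of `Tr[(â_ℓ ⊗ I) ρ̂_i ρ̂_j]` over `i ≠ j`. -/
def bipartiteMean (z : (Fin M → Matrix.unitaryGroup (a × b) ℂ × (a × b)) ×
    (Fin L → Matrix.unitaryGroup a ℂ × a)) : ℂ :=
  ((L * (M * (M - 1)) : ℕ) : ℂ)⁻¹ *
    ∑ l, ∑ i, ∑ j ∈ Finset.univ.erase i,
      ((shadow (z.2 l) ⊗ₖ (1 : Matrix b b ℂ)) * shadow (z.1 i) * shadow (z.1 j)).trace

lemma estT2_eq_re_bipartiteMean (hM : 1 ≤ M)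
    (z : (Fin M → Matrix.unitaryGroup (a × b) ℂ × (a × b)) ×
      (Fin L → Matrix.unitaryGroup a ℂ × a)) : estT2 z = (bipartiteMean z).re := by
  have h : ((L * (M * (M - 1)) : ℕ) : ℂ)⁻¹ = (((L : ℝ) * M * ((M : ℝ) - 1))⁻¹ : ℝ) := by
    push_cast [Nat.cast_sub hM]
    rw [mul_assoc]
  rw [bipartiteMean, h, Complex.re_ofReal_mul, estT2]

/-- The centred matrices of the two batches of runs. -/
def batchNoise (ρ : Matrix (a × b) (a × b) ℂ) (σ : Matrix a a ℂ) (M L : ℕ) :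
    ∀ j, BatchSpace (Matrix.unitaryGroup (a × b) ℂ × (a × b)) (Matrix.unitaryGroup a ℂ × a) M L j →
      Matrix (a × b) (a × b) ℂ
  | .inl _ => fun x => shadow x - ρ
  | .inr _ => fun x => (shadow x - σ) ⊗ₖ (1 : Matrix b b ℂ)

/-- The positions of the three runs entering one summand. -/
def batchIndex (p : Fin L × Fin M × Fin M) : Fin 3 → Fin M ⊕ Fin L :=
  ![.inr p.1, .inl p.2.1, .inl p.2.2]

lemma bipartiteMean_eq (ρ : Matrix (a × b) (a × b) ℂ) (σ : Matrix a a ℂ)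
    (x : ∀ j, BatchSpace (Matrix.unitaryGroup (a × b) ℂ × (a × b))
      (Matrix.unitaryGroup a ℂ × a) M L j) :
    bipartiteMean (fun i => x (.inl i), fun l => x (.inr l)) =
      (((Finset.univ : Finset (Fin L × Fin M × Fin M)).filter
        (fun p => p.2.1 ≠ p.2.2)).card : ℂ)⁻¹ *
        ∑ p ∈ (Finset.univ : Finset (Fin L × Fin M × Fin M)).filter (fun p => p.2.1 ≠ p.2.2),
          traceProd (a × b) 3 (fun s => batchNoise ρ σ M L (batchIndex p s) (x (batchIndex p s)) +
            (![σ ⊗ₖ 1, ρ, ρ] : Fin 3 → Matrix (a × b) (a × b) ℂ) s) := by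
  rw [bipartiteMean, card_filter_ne, sum_erase_eq_sum_filter (fun l i j =>
    ((shadow (x (.inr l)) ⊗ₖ (1 : Matrix b b ℂ)) * shadow (x (.inl i)) *
      shadow (x (.inl j))).trace)]
  congr 1
  refine Finset.sum_congr rfl fun p _ => ?_
  have h0 : batchNoise ρ σ M L (batchIndex p 0) (x (batchIndex p 0)) + σ ⊗ₖ (1 : Matrix b b ℂ) =
      shadow (x (.inr p.1)) ⊗ₖ (1 : Matrix b b ℂ) := by
    change (shadow (x (.inr p.1)) - σ) ⊗ₖ (1 : Matrix b b ℂ) + σ ⊗ₖ (1 : Matrix b b ℂ) = _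
    rw [← Matrix.add_kronecker, sub_add_cancel]
  have h1 : batchNoise ρ σ M L (batchIndex p 1) (x (batchIndex p 1)) + ρ =
      shadow (x (.inl p.2.1)) := sub_add_cancel _ _
  have h2 : batchNoise ρ σ M L (batchIndex p 2) (x (batchIndex p 2)) + ρ =
      shadow (x (.inl p.2.2)) := sub_add_cancel _ _
  rw [traceProd_apply, ← h0, ← h1, ← h2]
  simp [List.ofFn_succ, mul_assoc]

lemma traceProd_three_kronecker_one (σ : Matrix a a ℂ) (ρ : Matrix (a × b) (a × b) ℂ) :
    traceProd (a × b) 3 ![σ ⊗ₖ 1, ρ, ρ] = (σ * traceB (ρ ^ 2)).trace := by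
  rw [← trace_kronecker_one_mul, traceProd_apply]
  simp [List.ofFn_succ, sq]

lemma mul_mul_le_mul_card_ne {M : ℕ} (hM : 3 ≤ M) (L : ℕ) :
    (L : ℝ) * M * M ≤ 27 * ((L * (M * (M - 1)) : ℕ) : ℝ) := by
  have h : (3 : ℝ) ≤ M := by exact_mod_cast hM
  push_cast [Nat.cast_sub (show 1 ≤ M by omega)]
  have : (M : ℝ) * M ≤ 27 * (M * (M - 1)) := by nlinarith
  calc (L : ℝ) * M * M = L * (M * M) := mul_assoc _ _ _
    _ ≤ L * (27 * (M * (M - 1))) := mul_le_mul_of_nonneg_left this (Nat.cast_nonneg _)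
    _ = _ := by ring

variable [TopologicalSpace a] [DiscreteTopology a] [TopologicalSpace b] [DiscreteTopology b]

lemma continuous_bipartiteMean : Continuous (bipartiteMean :
    (Fin M → Matrix.unitaryGroup (a × b) ℂ × (a × b)) ×
      (Fin L → Matrix.unitaryGroup a ℂ × a) → ℂ) := by
  have h1 : ∀ k, Continuous fun z : (Fin M → Matrix.unitaryGroup (a × b) ℂ × (a × b)) ×
      (Fin L → Matrix.unitaryGroup a ℂ × a) => shadow (z.1 k) :=
    fun k => continuous_shadow.comp ((continuous_apply k).comp continuous_fst)
  have h2 : ∀ k, Continuous fun z : (Fin M → Matrix.unitaryGroup (a × b) ℂ × (a × b)) ×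
      (Fin L → Matrix.unitaryGroup a ℂ × a) => shadow (z.2 k) ⊗ₖ (1 : Matrix b b ℂ) :=
    fun k => continuous_matrix fun p q => ((continuous_shadow.comp
      ((continuous_apply k).comp continuous_snd)).matrix_elem p.1 q.1).mul continuous_const
  exact continuous_const.mul (continuous_finsetSum _ fun l _ => continuous_finsetSum _ fun i _ =>
    continuous_finsetSum _ fun j _ => (((h2 l).matrix_mul (h1 i)).matrix_mul (h1 j)).matrix_trace)

variable [MeasurableSpace a] [OpensMeasurableSpace a] [MeasurableSpace b] [OpensMeasurableSpace b]
  {ν : Measure (Matrix.unitaryGroup (a × b) ℂ)} [IsProbabilityMeasure ν]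
  {νA : Measure (Matrix.unitaryGroup a ℂ)} [IsProbabilityMeasure νA]
  {ρ : Matrix (a × b) (a × b) ℂ}

theorem estimatesWithin_estT2 (hρ : IsState ρ) (hν : IsUnitaryDesign 3 ν)
    (hνA : IsUnitaryDesign 3 νA) {ε : ℝ} {C : ℕ} (hC3 : 3 ≤ C) (hC : 3000000 / (C : ℝ) ≤ ε ^ 2)
    (hM : C * Fintype.card (a × b) ≤ M) (hL : C * Fintype.card (a × b) ≤ L) :
    EstimatesWithin ((dataLaw ν ρ M).prod (dataLaw νA (traceB ρ) L)) estT2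
      ((traceB ρ * traceB (ρ ^ 2)).trace).re ε := by
  have hσ : IsState (traceB ρ) := isState_traceB hρ
  set σ := traceB ρ with hσdef
  have hP := isProbabilityMeasure_runLaw (ν := ν) hρ
  have hQ := isProbabilityMeasure_runLaw (ν := νA) hσ
  have hn : 1 ≤ Fintype.card (a × b) := card_pos_of_isState hρ
  have ha : 1 ≤ Fintype.card a := card_pos_of_isState hσ
  have hab : Fintype.card (a × b) = Fintype.card a * Fintype.card b := Fintype.card_prod a b
  have hb : 1 ≤ Fintype.card b := Nat.pos_of_ne_zero fun h => by simp [hab, h] at hn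
  have hM3 : 3 ≤ M := three_le_of_mul_le hn hC3 hM
  have hL3 : 3 ≤ L := three_le_of_mul_le hn hC3 hL
  have hCr : (3 : ℝ) ≤ C := by exact_mod_cast hC3
  have hnr : (1 : ℝ) ≤ Fintype.card (a × b) := by exact_mod_cast hn
  have hacard : (Fintype.card a : ℝ) ≤ Fintype.card (a × b) := by
    exact_mod_cast hab ▸ Nat.le_mul_of_pos_right _ hb
  have hbcard : (Fintype.card b : ℝ) ≤ Fintype.card (a × b) := by
    exact_mod_cast hab ▸ Nat.le_mul_of_pos_left _ ha
  have hMn : (C : ℝ) * Fintype.card (a × b) ≤ M := by exact_mod_cast hM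
  have hLn : (C : ℝ) * Fintype.card (a × b) ≤ L := by exact_mod_cast hL
  have hnoise := isNoise_shadow hρ hν
  have hnoiseA := (isNoise_shadow_kronecker_one b hσ hνA).mono
    (mul_le_mul_of_nonneg_left hbcard (by norm_num : (0 : ℝ) ≤ 4))
    (mul_le_mul_of_nonneg_left hacard (by norm_num : (0 : ℝ) ≤ 4))
  let P := batchLaw (runLaw ν ρ) (runLaw νA σ) M L
  have hcont : ∀ j, Continuous (batchNoise ρ σ M L j)
    | .inl _ => hnoise.continuous
    | .inr _ => hnoiseA.continuous
  have hzero : ∀ j A, ∫ y, (batchNoise ρ σ M L j y * A).trace ∂(P j) = 0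
    | .inl _ => hnoise.integral_trace
    | .inr _ => hnoiseA.integral_trace
  have hτ : ∀ p ∈ (Finset.univ : Finset (Fin L × Fin M × Fin M)).filter (fun p => p.2.1 ≠ p.2.2),
      Function.Injective (batchIndex p) := fun p hp =>
    injective_vecCons_three (by simp) (by simp)
      (Sum.inl_injective.ne (Finset.mem_filter.1 hp).2)
  have hinj : Set.InjOn (batchIndex (L := L) (M := M))
      ((Finset.univ : Finset (Fin L × Fin M × Fin M)).filter (fun p => p.2.1 ≠ p.2.2)) :=
    fun p _ p' _ h => Prod.ext (Sum.inr_injective (congr_fun h 0))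
      (Prod.ext (Sum.inl_injective (congr_fun h 1)) (Sum.inl_injective (congr_fun h 2)))
  have hcard := card_filter_ne M L
  have hF : ((Finset.univ : Finset (Fin L × Fin M × Fin M)).filter
      (fun p => p.2.1 ≠ p.2.2)).Nonempty := by
    rw [← Finset.card_pos, hcard]
    exact Nat.mul_pos (by omega) (Nat.mul_pos (by omega) (by omega))
  let K : Fin 3 → Matrix (a × b) (a × b) ℂ := ![σ ⊗ₖ 1, ρ, ρ]
  -- Slot 0 draws from the runs on `ρ_A` and the other two from the runs on `ρ`. Both batches are at
  -- least `C` times the full dimension, as the counting requires.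
  let N : Fin 3 → Finset (Fin M ⊕ Fin L) := ![Finset.univ.map .inr, Finset.univ.map .inl,
    Finset.univ.map .inl]
  have hK0 : frobSq (σ ⊗ₖ (1 : Matrix b b ℂ)) ≤ Fintype.card (a × b) := by
    rw [frobSq_kronecker_one]
    exact (mul_le_of_le_one_right (Nat.cast_nonneg _) hσ.frobSq_le_one).trans hbcard
  have hN : ∀ p ∈ (Finset.univ : Finset (Fin L × Fin M × Fin M)).filter (fun p => p.2.1 ≠ p.2.2),
      ∀ s, batchIndex p s ∈ N s := by
    intro p _ s
    fin_cases s <;> simp [N, batchIndex]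
  have hq : (∏ s, ((N s).card : ℝ)) ≤ 27 * (((Finset.univ : Finset (Fin L × Fin M × Fin M)).filter
      (fun p => p.2.1 ≠ p.2.2)).card : ℝ) := by
    rw [hcard, Fin.prod_univ_three]
    simpa [N] using mul_mul_le_mul_card_ne hM3 L
  have hcD : ∀ s, (C : ℝ) * Fintype.card (a × b) ≤ (N s).card := by
    intro s
    fin_cases s
    · simpa [N] using hLn
    · simpa [N] using hMn
    · simpa [N] using hMn
  have hPM : IsProbabilityMeasure (dataLaw ν ρ M) := by unfold dataLaw; infer_instance
  have hQL : IsProbabilityMeasure (dataLaw νA σ L) := by unfold dataLaw; infer_instance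
  have hoM : OpensMeasurableSpace (Fin M → Matrix.unitaryGroup (a × b) ℂ × (a × b)) :=
    inferInstance
  have hoL : OpensMeasurableSpace (Fin L → Matrix.unitaryGroup a ℂ × a) := inferInstance
  have hcL : SecondCountableTopology (Fin L → Matrix.unitaryGroup a ℂ × a) := inferInstance
  refine estimatesWithin_of_re continuous_bipartiteMean
    (estT2_eq_re_bipartiteMean (by omega)) ?_ ?_
  · rw [dataLaw, dataLaw, integral_batchLaw]
    simp only [bipartiteMean_eq ρ σ]
    rw [← traceProd_three_kronecker_one]
    exact integral_mean_traceProd (Z := batchNoise ρ σ M L) (C := K) hcont hzero hF hτ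
  · rw [dataLaw, dataLaw, integral_batchLaw]
    simp only [bipartiteMean_eq ρ σ]
    rw [← traceProd_three_kronecker_one]
    refine (integral_norm_mean_traceProd_sub_sq_le (Z := batchNoise ρ σ M L) (C := K) (N := N)
      (B := 64) (D := Fintype.card (a × b)) (c := C) (q := 27) hcont hzero hF hτ hinj hN
      (by norm_num) (by linarith) (by linarith) (by norm_num) (fun s hs p hp => ?_) hq hcD).trans ?_
    · exact integral_norm_noiseTerm_three_le (C := K) (T := batchIndex p)
        (Z := batchNoise ρ σ M L) (P := P) hn hK0 hρ.frobSq_le_one hρ.frobSq_le_one (hτ p hp)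
        hnoiseA hnoise hnoise hs
    · refine le_trans ?_ hC
      rw [← mul_div_assoc]
      exact div_le_div_of_nonneg_right (by norm_num) (by linarith)

end Bipartite

end ClassicalShadow

end

theorem mainTheorem10 (ε : ℝ) (hε : 0 < ε) :
    ∃ C : ℕ, ∀ (d D : ℕ) (_hD : D = d * d)
      (ρ : Matrix (Fin d × Fin d) (Fin d × Fin d) ℂ) (_hρ : ClassicalShadow.IsState ρ)
      (ν : Measure (Matrix.unitaryGroup (Fin d × Fin d) ℂ)) (_ : IsProbabilityMeasure ν)
      (_hν : ClassicalShadow.IsUnitaryDesign 3 ν)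
      (νA : Measure (Matrix.unitaryGroup (Fin d) ℂ)) (_ : IsProbabilityMeasure νA)
      (_hνA : ClassicalShadow.IsUnitaryDesign 3 νA)
      (M L : ℕ) (_hM : C * D ≤ M) (_hL : C * D ≤ L),
      -- the second and third moments of `ρ`, from `M` runs on `ρ`
      ClassicalShadow.EstimatesWithin (ClassicalShadow.dataLaw ν ρ M)
        ClassicalShadow.estSecond ((ρ ^ 2).trace).re ε ∧
      ClassicalShadow.EstimatesWithin (ClassicalShadow.dataLaw ν ρ M)
        ClassicalShadow.estThird ((ρ ^ 3).trace).re ε ∧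
      -- the second and third moments of `ρ_A`, from `L` runs on `ρ_A`
      ClassicalShadow.EstimatesWithin
        (ClassicalShadow.dataLaw νA (ClassicalShadow.traceB ρ) L)
        ClassicalShadow.estSecond ((ClassicalShadow.traceB ρ ^ 2).trace).re ε ∧
      ClassicalShadow.EstimatesWithin
        (ClassicalShadow.dataLaw νA (ClassicalShadow.traceB ρ) L)
        ClassicalShadow.estThird ((ClassicalShadow.traceB ρ ^ 3).trace).re ε ∧
      -- `t₂ = Tr_A[ρ_A Tr_B(ρ²)]`, from `M` runs on `ρ` and `L` further runs on `ρ_A`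
      ClassicalShadow.EstimatesWithin
        ((ClassicalShadow.dataLaw ν ρ M).prod
          (ClassicalShadow.dataLaw νA (ClassicalShadow.traceB ρ) L))
        ClassicalShadow.estT2
        ((ClassicalShadow.traceB ρ * ClassicalShadow.traceB (ρ ^ 2)).trace).re ε := by
  have hε2 : 0 < ε ^ 2 := by positivity
  -- The general bound with `r = 3`, `q = 27`, `B = 64` gives `4³ * 3³ * 27 * 64 = 2985984`, divided
  -- by `C`. The `+ 3` forces at least three runs, so the binomial coefficients do not vanish.
  refine ⟨⌈3000000 / ε ^ 2⌉₊ + 3, ?_⟩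
  have hC3 : 3 ≤ ⌈3000000 / ε ^ 2⌉₊ + 3 := by omega
  have hC : 3000000 / ((⌈3000000 / ε ^ 2⌉₊ + 3 : ℕ) : ℝ) ≤ ε ^ 2 := by
    have h : 3000000 / ε ^ 2 ≤ ((⌈3000000 / ε ^ 2⌉₊ + 3 : ℕ) : ℝ) := by
      push_cast
      linarith [Nat.le_ceil (3000000 / ε ^ 2)]
    rw [div_le_iff₀ hε2] at h
    rw [div_le_iff₀ (by positivity)]
    linarith
  generalize ⌈3000000 / ε ^ 2⌉₊ + 3 = C at hC3 hC
  rintro d _ rfl ρ hρ ν _ hν νA _ hνA M L hM hL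
  have hσ : ClassicalShadow.IsState (ClassicalShadow.traceB ρ) := ClassicalShadow.isState_traceB hρ
  -- A state of trace 1 rules out `d = 0`; then `d ≤ d * d`, so `L` is also large enough for the
  -- estimators on `ρ_A` alone.
  have hd : 0 < d := by simpa using ClassicalShadow.card_pos_of_isState hσ
  have hcard : Fintype.card (Fin d × Fin d) = d * d := by simp
  have hL' : C * Fintype.card (Fin d) ≤ L := by
    rw [Fintype.card_fin]
    exact (Nat.mul_le_mul_left C (Nat.le_mul_of_pos_left d hd)).trans hL
  rw [← hcard] at hM hL
  exact ⟨ClassicalShadow.estimatesWithin_estSecond hρ hν hC3 hC hM,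
    ClassicalShadow.estimatesWithin_estThird hρ hν hC3 hC hM,
    ClassicalShadow.estimatesWithin_estSecond hσ hνA hC3 hC hL',
    ClassicalShadow.estimatesWithin_estThird hσ hνA hC3 hC hL',
    ClassicalShadow.estimatesWithin_estT2 hρ hν hνA hC3 hC hM hL⟩
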